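/- Let $D\subset\mathbb R^2$ be a diagram of an oriented link $L$ with $n_+$ positive and $n_-$ negative crossings, and let $\gamma\in\{0,1\}$ be the number of components of $L$ mod $2$. Let $A=\mathbb F_2\{1,x\}$ and let $C=\bigoplus_{i,j}C^{i,j}$, $C^{i,*}=\bigoplus_\alpha A^{\otimes\,\mathrm{circles}(\alpha)}$ (sum over complete smoothings $\alpha$ with $i+n_-$ one-smoothings), with $q$-degree $j=\#\{1\}-\#\{x\}+(\text{number of one-smoothings of }\alpha)+n_+-2n_-$ on labellings of circles by $1,x$. Summing over the edges of the cube of smoothings, where a merge acts by a multiplication and a split by a comultiplication, define three maps on $C$: * $\partial$ (Khovanov), from $1$ a unit, $x\cdot x=0$, $\Delta(1)=1\otimes x+x\otimes1$, $\Delta(x)=x\otimes x$; * $\beta$, from $\tilde m(x,x)=x$, $\tilde\Delta(1)=1\otimes1$, all other values being $0$; * $d$ (Bar-Natan, $u=1$), from $1$ a unit, $x\cdot x=x$, $\Delta(1)=1\otimes x+x\otimes1+1\otimes1$, $\Delta(x)=x\otimes x$. Then $\partial^2=0$, $d^2=0$, $d=\partial+\beta$, where $\partial$ has bidegree $(1,0)$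 and $\beta$ has bidegree $(1,2)$. The map $\beta$ induces $\beta_*\colon Kh^{i,j}\to Kh^{i+1,j+2}$ on $Kh^{i,j}=H^i(C^{*,j},\partial)$ with $\beta_*^2=0$. Put $\mathcal K^{i,j}=\ker(\beta_*\colon Kh^{i,j}\to Kh^{i+1,j+2})/\operatorname{im}(\beta_*\colon Kh^{i-1,j-2}\to Kh^{i,j})$ and $BN^i=H^i(C,d)$. Further, $C^{i,j}=0$ unless $j\equiv\gamma$ mod $2$. **Theorem.** Let $F^kC$ be the span of the homogeneous elements of $q$-degree at least $2k+\gamma$. Then $(C,d)$ with $F^*$ is a bounded filtered complex, and its spectral sequence $(E_r^{k,l},d_r)_{r\ge0}$, $d_r\colon E_r^{k,l}\to E_r^{k+r,l+1-r}$, satisfies: 1. $E_0^{k,l}\cong C^{k+l,2k+\gamma}$ with $d_0=\partial$; 2. $E_1^{k,l}\cong Kh^{k+l,2k+\gamma}$ with $d_1=\beta_*$; 3. $E_2^{k,l}\cong\mathcal K^{k+l,2k+\gamma}$; 4. it converges to $BN^*$: with $F^kBN^i=\operatorname{im}(H^i(F^kC,d)\to BN^i)$, a finite filtration from $BN^i$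 to $0$, there is an $R$ such that for all $r\ge R$ one has $d_r=0$ and $E_r^{k,l}\cong F^kBN^{k+l}/F^{k+1}BN^{k+l}$ for all $k,l$. All these isomorphisms are the ones given by representatives. **Reduced version.** Choose a base point on $D$, let $x$ act on $C$ by multiplication (with $x\cdot x=0$) on the circle through the base point, and let $\widetilde C=C\otimes_A A/xA=C/xC$, with the $q$-degree lowered by $1$ (so that the reduced homology of the unknot lies in degree $0$). Then $\partial$, $\beta$ and $d$ descend to $\widetilde C$, and everything above holds for $\widetilde C$ and its homologies with $\gamma$ replaced by $\gamma+1$; in particular there is a spectral sequence with $E_1^{k,l}\cong\widetilde{Kh}^{k+l,2k+\gamma+1}$ and $d_1=\tilde\beta_*$ that converges to reduced filtered Bar-Natan homology. -/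

import Mathlib

open CategoryTheory

namespace BarNatan

/-- The field with two elements. -/
abbrev F2 : Type := ZMod 2

/-! ## Oriented link diagrams -/

/-- The half-edges at `n` crossings.  The four half-edges of a crossing are numbered `0, 1, 2, 3`
counterclockwise, starting at the incoming half-edge of the strand that passes under. -/
abbrev Dart (n : ℕ) : Type := Fin n × Fin 4

/-- The next half-edge at the same crossing, counterclockwise. -/
def rot {n : ℕ} (a : Dart n) : Dart n := (a.1, a.2 + 1)

/-- The half-edge at the same crossing that continues the strand straight on. -/
def straight {n : ℕ} (a : Dart n) : Dart n := (a.1, a.2 + 2)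

/-- Whether a half-edge points away from its crossing.  The under-strand runs from `0` to `2`; the
over-strand runs from `3` to `1` at a positive crossing and from `1` to `3` at a negative one. -/
def isOut {n : ℕ} (positive : Fin n → Bool) (a : Dart n) : Bool :=
  (![false, positive a.1, true, !positive a.1] : Fin 4 → Bool) a.2

/-- The faces of the combinatorial map underlying a diagram. -/
def Face {n : ℕ} (glue : Dart n → Dart n) : Type :=
  Quot fun a b : Dart n => b = rot (glue a)

/-- The connected pieces of the 4-valent graph underlying a diagram. -/
def Piece {n : ℕ} (glue : Dart n → Dart n) : Type :=
  Quot fun a b : Dart n => b = glue a ∨ b = rot a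

/-- An oriented link diagram in the plane, up to planar isotopy (a planar diagram code): a 4-valent
graph given by its crossings and the gluing of the half-edges into edges, with over/under
information and orientation, together with a number of crossingless circle components. -/
structure LinkDiagram where
  /-- the number of crossings -/
  n : ℕ
  /-- the number of circle components without crossings -/
  free : ℕ
  /-- the other half of the edge that contains a given half-edge -/
  glue : Dart n → Dart n
  /-- whether a crossing is positive -/
  positive : Fin n → Bool
  glue_glue : ∀ a, glue (glue a) = a
  /-- every edge leads from an outgoing to an incoming half-edge -/
  orient : ∀ a, isOut positive (glue a) = !isOut positive a
  /-- Euler's formula `V - E + F = 2 · #pieces`, with `V = n` and `E = 2n`: each piece has genus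
  zero, that is, the diagram lies in the plane -/
  planar : Nat.card (Face glue) = n + 2 * Nat.card (Piece glue)

namespace LinkDiagram

/-- The places on a diagram: its half-edges and its crossingless circles. -/
abbrev Point (D : LinkDiagram) : Type := Dart D.n ⊕ Fin D.free

/-- Two places that follow each other along a component of the link. -/
inductive Along (D : LinkDiagram) : D.Point → D.Point → Prop
  | edge (a : Dart D.n) : Along D (.inl a) (.inl (D.glue a))
  | cross (a : Dart D.n) : Along D (.inl a) (.inl (straight a))

/-- The components of the link. -/
def Component (D : LinkDiagram) : Type := Quot D.Along

/-- The number of components of the link modulo 2, as `0` or `1`. -/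
noncomputable def gamma (D : LinkDiagram) : ℤ := ((Nat.card D.Component % 2 : ℕ) : ℤ)

/-- The number of positive crossings. -/
def nPlus (D : LinkDiagram) : ℤ := ((Finset.univ.filter fun x => D.positive x = true).card : ℤ)

/-- The number of negative crossings. -/
def nMinus (D : LinkDiagram) : ℤ := ((Finset.univ.filter fun x => D.positive x = false).card : ℤ)

/-- A complete smoothing: `false` is the 0-smoothing and `true` the 1-smoothing of a crossing. -/
abbrev Smoothing (D : LinkDiagram) : Type := Fin D.n → Bool

/-- The half-edge joined to a given one when the crossing is smoothed.  The 0-smoothing, which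
joins the two regions swept by the over-strand when it is turned counterclockwise, joins `0` with
`1` and `2` with `3`; the 1-smoothing joins `0` with `3` and `1` with `2`. -/
def partner (b : Bool) (i : Fin 4) : Fin 4 :=
  match b with
  | false => (![1, 0, 3, 2] : Fin 4 → Fin 4) i
  | true => (![3, 2, 1, 0] : Fin 4 → Fin 4) i

/-- Two places that follow each other along a circle of the complete smoothing `α`. -/
inductive Touch (D : LinkDiagram) (α : D.Smoothing) : D.Point → D.Point → Prop
  | edge (a : Dart D.n) : Touch D α (.inl a) (.inl (D.glue a))
  | smooth (a : Dart D.n) : Touch D α (.inl a) (.inl (a.1, partner (α a.1) a.2))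

/-- The circles of the complete smoothing `α`. -/
def Circle (D : LinkDiagram) (α : D.Smoothing) : Type := Quot (D.Touch α)

/-- The circle of `α` through the place `p`. -/
def circle (D : LinkDiagram) (α : D.Smoothing) (p : D.Point) : D.Circle α := Quot.mk _ p

instance (D : LinkDiagram) (α : D.Smoothing) : Finite (D.Circle α) :=
  inferInstanceAs (Finite (Quot (D.Touch α)))

noncomputable instance (D : LinkDiagram) (α : D.Smoothing) : Fintype (D.Circle α) :=
  Fintype.ofFinite _

end LinkDiagram

/-! ## The operations on `A = F2{1, x}` -/

/-- The basis `1, x` of the Frobenius algebra. -/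
inductive Label : Type
  | one
  | x

instance : Finite Label :=
  Finite.of_injective (fun s : Label => match s with | .one => false | .x => true)
    (by intro a b h; cases a <;> cases b <;> simp_all)

/-- A multiplication and a comultiplication on `A`, by their structure constants: `mul a b c` is
the coefficient of `c` in the product of `a` and `b`, and `comul a b c` is the coefficient of
`b ⊗ c` in the coproduct of `a`. -/
structure Ops where
  mul : Label → Label → Label → F2
  comul : Label → Label → Label → F2

/-- The operations of Bar-Natan's theory with `u` in `F2`: `1` is the unit, `m(x, x) = u x`,
`Δ(1) = 1 ⊗ x + x ⊗ 1 + u 1 ⊗ 1` and `Δ(x) = x ⊗ x`. -/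
def bnOps (u : F2) : Ops where
  mul
    | .one, .one, .one => 1
    | .one, .x, .x => 1
    | .x, .one, .x => 1
    | .x, .x, .x => u
    | _, _, _ => 0
  comul
    | .one, .one, .x => 1
    | .one, .x, .one => 1
    | .one, .one, .one => u
    | .x, .x, .x => 1
    | _, _, _ => 0

/-- The operations of Khovanov's theory over `F2`: `1` is the unit, `m(x, x) = 0`,
`Δ(1) = 1 ⊗ x + x ⊗ 1` and `Δ(x) = x ⊗ x`. -/
def khOps : Ops := bnOps 0

/-- The operations that define `β`: `m(x, x) = x` and `Δ(1) = 1 ⊗ 1` are the only nonzero values. -/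
def betaOps : Ops where
  mul
    | .x, .x, .x => 1
    | _, _, _ => 0
  comul
    | .one, .one, .one => 1
    | _, _, _ => 0

namespace LinkDiagram

/-! ## The cube of smoothings -/

/-- The standard basis of the chain groups: a complete smoothing `α` and a basis element of
`A^{⊗ circles of α}`, that is, a labelling of the circles by `1` and `x`. -/
abbrev State (D : LinkDiagram) : Type := Σ α : D.Smoothing, (D.Circle α → Label)

noncomputable instance (D : LinkDiagram) : Fintype D.State := Fintype.ofFinite _

/-- The label of the circle through the place `p`. -/
def State.lab {D : LinkDiagram} (S : D.State) (p : D.Point) : Label := S.2 (D.circle S.1 p)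

/-- The number of 1-smoothings. -/
def State.height {D : LinkDiagram} (S : D.State) : ℤ :=
  ((Finset.univ.filter fun x => S.1 x = true).card : ℤ)

/-- The homological degree. -/
def State.hdeg {D : LinkDiagram} (S : D.State) : ℤ := S.height - D.nMinus

/-- The `q`-degree, where `1` has degree `1` and `x` has degree `-1`. -/
noncomputable def State.qdeg {D : LinkDiagram} (S : D.State) : ℤ :=
  (∑ c, match S.2 c with
    | .one => (1 : ℤ)
    | .x => (-1 : ℤ)) + S.height + D.nPlus - 2 * D.nMinus

/-- The underlying vector space of the Khovanov complex and of the `u = 1` Bar-Natan complex. -/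
abbrev Chain (D : LinkDiagram) : Type := D.State → F2

/-- The chains that are homogeneous of bidegree `(i, j)`. -/
def chainDeg (D : LinkDiagram) (i j : ℤ) : Submodule F2 D.Chain where
  carrier := {v | ∀ S, v S ≠ 0 → S.hdeg = i ∧ S.qdeg = j}
  zero_mem' := by intro S h; exact absurd rfl h
  add_mem' := by
    intro v w hv hw S h
    by_cases h0 : v S = 0
    · exact hw S fun h1 => h (by simp [h0, h1])
    · exact hv S h0
  smul_mem' := by
    intro c v hv S h
    exact hv S fun h0 => h (by simp [h0])

open Classical in
/-- The coefficient of `T` in the image of `S` under the map that `O` assigns to the elementary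
cobordism at the crossing `x`.  It is zero unless `T` is obtained from `S` by changing `x` from its
0-smoothing to its 1-smoothing and the circles not involved keep their labels.  If this merges two
circles, multiply; if it splits one circle into two, comultiply.  (In a planar diagram one
of these always happens; otherwise the coefficient is set to zero.) -/
noncomputable def edgeCoeff (D : LinkDiagram) (O : Ops) (x : Fin D.n) (S T : D.State) : F2 :=
  let a : D.Point := .inl (x, 0)
  let b : D.Point := .inl (x, 2)
  if S.1 x = false ∧ T.1 = Function.update S.1 x true ∧
      ∀ p : D.Point, D.circle S.1 p ≠ D.circle S.1 a → D.circle S.1 p ≠ D.circle S.1 b →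
        T.lab p = S.lab p then
    if D.circle S.1 a = D.circle S.1 b then
      if D.circle T.1 a = D.circle T.1 b then 0
      else O.comul (S.lab a) (T.lab a) (T.lab b)
    else O.mul (S.lab a) (S.lab b) (T.lab a)
  else 0

/-- The sum over all edges of the cube of smoothings of the maps that `O` assigns to them. -/
noncomputable def cubeMap (D : LinkDiagram) (O : Ops) : D.Chain →ₗ[F2] D.Chain :=
  Matrix.mulVecLin (Matrix.of fun T S : D.State => ∑ x : Fin D.n, D.edgeCoeff O x S T)

open Classical in
/-- Multiplication by `x` (in the Khovanov algebra) on the circle through the place `p`: the action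
of `x` in the `A`-module structure on the complex given by the base point `p`. -/
noncomputable def xAct (D : LinkDiagram) (p : D.Point) : D.Chain →ₗ[F2] D.Chain :=
  Matrix.mulVecLin (Matrix.of fun T S : D.State =>
    if T.1 = S.1 ∧ ∀ q : D.Point, D.circle S.1 q ≠ D.circle S.1 p → T.lab q = S.lab q then
      khOps.mul .x (S.lab p) (T.lab p)
    else 0)

end LinkDiagram

/-! ## Khovanov, secondary and filtered homology -/

/-- The subquotient `Z / (Z ∩ B)`. -/
abbrev Subquot {V : Type} [AddCommGroup V] [Module F2 V] (Z B : Submodule F2 V) : Type :=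
  Z ⧸ B.submoduleOf Z

/-- The class of an element of `Z` in `Z / (Z ∩ B)`. -/
def cls {V : Type} [AddCommGroup V] [Module F2 V] (Z B : Submodule F2 V) (z : V) (hz : z ∈ Z) :
    Subquot Z B :=
  Submodule.Quotient.mk ⟨z, hz⟩

open Classical in
/-- The map of subquotients induced by `f`; by convention zero if `f` does not induce one. -/
noncomputable def inducedMap {V : Type} [AddCommGroup V] [Module F2 V] (f : V →ₗ[F2] V)
    (Z B Z' B' : Submodule F2 V) : Subquot Z B →ₗ[F2] Subquot Z' B' :=
  if h : (∀ z ∈ Z, f z ∈ Z') ∧ ∀ z ∈ Z, z ∈ B → f z ∈ B' then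
    Submodule.mapQ _ _ (f.restrict h.1) fun z hz => h.2 z.1 z.2 hz
  else 0

open Classical in
/-- The map of `V / N` induced by `f`; by convention zero if `f` does not induce one. -/
noncomputable def quotMap {V : Type} [AddCommGroup V] [Module F2 V] (N : Submodule F2 V)
    (f : V →ₗ[F2] V) : (V ⧸ N) →ₗ[F2] (V ⧸ N) :=
  if h : N ≤ N.comap f then N.mapQ N f h else 0

/-- A bigraded vector space with three endomorphisms: Khovanov's differential, `β`, and the
differential of the `u = 1` Bar-Natan theory.  Only the instances `LinkDiagram.theory` and
`LinkDiagram.reducedTheory` are used. -/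
structure Theory where
  V : Type
  [grp : AddCommGroup V]
  [mod : Module F2 V]
  /-- the part of homological degree `i` and `q`-degree `j` -/
  bideg (i j : ℤ) : Submodule F2 V
  /-- Khovanov's differential -/
  del : V →ₗ[F2] V
  beta : V →ₗ[F2] V
  /-- Bar-Natan's differential for `u = 1` -/
  d : V →ₗ[F2] V

attribute [instance] Theory.grp Theory.mod

/-- The unreduced theory of a diagram. -/
noncomputable def LinkDiagram.theory (D : LinkDiagram) : Theory where
  V := D.Chain
  bideg := D.chainDeg
  del := D.cubeMap khOps
  beta := D.cubeMap betaOps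
  d := D.cubeMap (bnOps 1)

/-- The submodule `x C` of the complex `C`, for the base point `p`. -/
noncomputable def LinkDiagram.xChain (D : LinkDiagram) (p : D.Point) : Submodule F2 D.Chain :=
  LinearMap.range (D.xAct p)

/-- The reduced theory of a diagram with base point `p`: it lives on `C ⊗_A (A / xA) = C / x C`.
The `q`-degree is shifted by one, so that the reduced homology of the unknot is in degree `0`. -/
noncomputable def LinkDiagram.reducedTheory (D : LinkDiagram) (p : D.Point) : Theory where
  V := D.Chain ⧸ D.xChain p
  bideg i j := (D.chainDeg i (j + 1)).map (D.xChain p).mkQ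
  del := quotMap (D.xChain p) (D.cubeMap khOps)
  beta := quotMap (D.xChain p) (D.cubeMap betaOps)
  d := quotMap (D.xChain p) (D.cubeMap (bnOps 1))

namespace Theory

/-- The cochains of homological degree `i`. -/
def cochains (K : Theory) (i : ℤ) : Submodule F2 K.V := ⨆ j, K.bideg i j

/-- The step `F^k` of the `q`-filtration: sums of homogeneous elements of `q`-degree at least
`2k + c`. -/
def fil (K : Theory) (c k : ℤ) : Submodule F2 K.V :=
  ⨆ (i : ℤ) (j : ℤ) (_ : 2 * k + c ≤ j), K.bideg i j

/-- Cocycles of Khovanov's complex. -/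
def khZ (K : Theory) (i j : ℤ) : Submodule F2 K.V := K.bideg i j ⊓ LinearMap.ker K.del

/-- Coboundaries of Khovanov's complex. -/
def khB (K : Theory) (i j : ℤ) : Submodule F2 K.V := (K.bideg (i - 1) j).map K.del

/-- Khovanov homology in bidegree `(i, j)`. -/
abbrev Kh (K : Theory) (i j : ℤ) : Type := Subquot (K.khZ i j) (K.khB i j)

/-- The map `β_*` on Khovanov homology, to be used for `i' = i + 1` and `j' = j + 2`. -/
noncomputable def betaStar (K : Theory) (i j i' j' : ℤ) : K.Kh i j →ₗ[F2] K.Kh i' j' :=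
  inducedMap K.beta (K.khZ i j) (K.khB i j) (K.khZ i' j') (K.khB i' j')

/-- The kernel of `β_*` in bidegree `(i, j)`. -/
noncomputable def secZ (K : Theory) (i j : ℤ) : Submodule F2 (K.Kh i j) :=
  LinearMap.ker (K.betaStar i j (i + 1) (j + 2))

/-- The image of `β_*` in bidegree `(i, j)`. -/
noncomputable def secB (K : Theory) (i j : ℤ) : Submodule F2 (K.Kh i j) :=
  LinearMap.range (K.betaStar (i - 1) (j - 2) i j)

/-- The secondary groups: the homology of Khovanov homology with respect to `β_*`. -/
abbrev Sec (K : Theory) (i j : ℤ) : Type := Subquot (K.secZ i j) (K.secB i j)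

/-- Cocycles of the `u = 1` Bar-Natan complex. -/
def bnZ (K : Theory) (i : ℤ) : Submodule F2 K.V := K.cochains i ⊓ LinearMap.ker K.d

/-- Coboundaries of the `u = 1` Bar-Natan complex. -/
def bnB (K : Theory) (i : ℤ) : Submodule F2 K.V := (K.cochains (i - 1)).map K.d

/-- Filtered (`u = 1`) Bar-Natan homology. -/
abbrev BN (K : Theory) (i : ℤ) : Type := Subquot (K.bnZ i) (K.bnB i)

/-- The filtration of Bar-Natan homology: the image of the homology of `F^k`. -/
def filBN (K : Theory) (c k i : ℤ) : Submodule F2 (K.BN i) :=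
  ((K.fil c k).submoduleOf (K.bnZ i)).map (Submodule.mkQ _)

/-- The associated graded `F^k H^i / F^{k+1} H^i` of Bar-Natan homology. -/
abbrev grBN (K : Theory) (c k i : ℤ) : Type := Subquot (K.filBN c k i) (K.filBN c (k + 1) i)

/-! ## The spectral sequence of the filtered complex -/

/-- The elements of `F^k` of homological degree `n` with `d z ∈ F^{k+r}`. -/
def ssZ (K : Theory) (c r k n : ℤ) : Submodule F2 K.V :=
  K.fil c k ⊓ K.cochains n ⊓ (K.fil c (k + r)).comap K.d

/-- The denominator in `E_r^{k, n-k} = Z_r^k / (Z_{r-1}^{k+1} + d Z_{r-1}^{k-r+1})`. -/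
def ssB (K : Theory) (c r k n : ℤ) : Submodule F2 K.V :=
  K.ssZ c (r - 1) (k + 1) n ⊔ (K.ssZ c (r - 1) (k - r + 1) (n - 1)).map K.d

/-- `(V, d)` with the filtration `F^k` is a bounded filtered complex, the two summands of
`d = ∂ + β` have bidegrees `(1, 0)` and `(1, 2)`, and `β` induces a differential `β_*` on Khovanov
homology. -/
structure IsFilteredComplex (K : Theory) (c : ℤ) : Prop where
  finite : Module.Finite F2 K.V
  bigraded : DirectSum.IsInternal fun ij : ℤ × ℤ => K.bideg ij.1 ij.2
  parity : ∀ i j, (¬ ∃ k, j = 2 * k + c) → K.bideg i j = ⊥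
  d_eq : K.d = K.del + K.beta
  del_mem : ∀ i j, ∀ z ∈ K.bideg i j, K.del z ∈ K.bideg (i + 1) j
  beta_mem : ∀ i j, ∀ z ∈ K.bideg i j, K.beta z ∈ K.bideg (i + 1) (j + 2)
  del_del : K.del ∘ₗ K.del = 0
  d_d : K.d ∘ₗ K.d = 0
  d_mem : ∀ i, ∀ z ∈ K.cochains i, K.d z ∈ K.cochains (i + 1)
  d_fil : ∀ k, ∀ z ∈ K.fil c k, K.d z ∈ K.fil c k
  fil_anti : Antitone (K.fil c)
  fil_bot : ∃ k, K.fil c k = ⊥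
  fil_top : ∃ k, K.fil c k = ⊤
  betaStar_cls : ∀ i j z, ∀ hz : z ∈ K.khZ i j, ∃ h : K.beta z ∈ K.khZ (i + 1) (j + 2),
    K.betaStar i j (i + 1) (j + 2) (cls _ _ z hz) = cls _ _ (K.beta z) h
  betaStar_betaStar : ∀ i j,
    K.betaStar (i + 1) (j + 2) (i + 1 + 1) (j + 2 + 2) ∘ₗ K.betaStar i j (i + 1) (j + 2) = 0

/-- Data exhibiting `E` as the spectral sequence of the filtered complex `(V, d)`: surjections
`π : Z_r^k → E_r^{k,l}` with the standard kernel, such that the differential of `E_r` is induced by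
`d` and the isomorphism `H(E_r) ≅ E_{r+1}` is the identity on representatives. -/
structure Presents (K : Theory) (c : ℤ)
    (E : CohomologicalSpectralSequence (ModuleCat.{0} F2) 0) where
  π (r : ℤ) (hr : 0 ≤ r) (k l : ℤ) : K.ssZ c r k (k + l) →ₗ[F2] (E.page r hr).X (k, l)
  surj : ∀ r hr k l, Function.Surjective (π r hr k l)
  ker : ∀ r hr k l,
    LinearMap.ker (π r hr k l) = (K.ssB c r k (k + l)).submoduleOf (K.ssZ c r k (k + l))
  diff : ∀ r hr k l (z : K.ssZ c r k (k + l)),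
    ∃ h : K.d z.1 ∈ K.ssZ c r (k + r) (k + r + (l + 1 - r)),
      (E.page r hr).d (k, l) (k + r, l + 1 - r) (π r hr k l z) =
        π r hr (k + r) (l + 1 - r) ⟨K.d z.1, h⟩
  iso : ∀ r hr k l (z : K.V) (h : z ∈ K.ssZ c r k (k + l)) (h' : z ∈ K.ssZ c (r + 1) k (k + l))
    (y : (E.page r hr).cycles (k, l)), (E.page r hr).iCycles (k, l) y = π r hr k l ⟨z, h⟩ →
      (E.iso r (r + 1) (k, l) rfl hr).hom ((E.page r hr).homologyπ (k, l) y) =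
        π (r + 1) (by lia) k l ⟨z, h'⟩

/-- The spectral sequence converges to Bar-Natan homology: the filtration of `H^i` is finite and
exhaustive, and from some page on all differentials vanish and `E_r^{k,l}` is
`F^k H^{k+l} / F^{k+1} H^{k+l}`, by the map that sends the class of a cocycle to its class. -/
def Presents.Converges {K : Theory} {c : ℤ}
    {E : CohomologicalSpectralSequence (ModuleCat.{0} F2) 0} (P : K.Presents c E) : Prop :=
  (∀ i, Antitone fun k => K.filBN c k i) ∧
  (∃ k, ∀ i, K.filBN c k i = ⊥) ∧ (∃ k, ∀ i, K.filBN c k i = ⊤) ∧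
  ∃ R : ℤ, 0 ≤ R ∧ ∀ (r : ℤ) (hr : 0 ≤ r), R ≤ r →
    (∀ a b, (E.page r hr).d a b = 0) ∧
    ∀ k l, ∃ e : (E.page r hr).X (k, l) ≃ₗ[F2] K.grBN c k (k + l),
      ∀ (z : K.V) (h : z ∈ K.ssZ c r k (k + l)) (hz : z ∈ K.bnZ (k + l)),
        ∃ h' : cls (K.bnZ (k + l)) (K.bnB (k + l)) z hz ∈ K.filBN c k (k + l),
          e (P.π r hr k l ⟨z, h⟩) = cls _ _ (cls _ _ z hz) h'

/-- The first pages of the spectral sequence: `E_0` is Khovanov's complex, `E_1` is Khovanov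
homology with `d_1 = β_*`, and `E_2` is given by the secondary groups, all in bidegree
`(k + l, 2k + c)`.  The identifications are the ones given by representatives. -/
structure Presents.FirstPages {K : Theory} {c : ℤ}
    {E : CohomologicalSpectralSequence (ModuleCat.{0} F2) 0} (P : K.Presents c E) where
  e₀ (k l : ℤ) : (E.page 0).X (k, l) ≃ₗ[F2] K.bideg (k + l) (2 * k + c)
  e₀_cls : ∀ k l (z : K.V) (hz : z ∈ K.bideg (k + l) (2 * k + c)),
    ∃ h : z ∈ K.ssZ c 0 k (k + l), e₀ k l (P.π 0 le_rfl k l ⟨z, h⟩) = ⟨z, hz⟩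
  e₀_diff : ∀ k l ξ, (e₀ k (l + 1) ((E.page 0).d (k, l) (k, l + 1) ξ) : K.V) = K.del (e₀ k l ξ)
  e₁ (k l : ℤ) : (E.page 1).X (k, l) ≃ₗ[F2] K.Kh (k + l) (2 * k + c)
  e₁_cls : ∀ k l (z : K.V) (hz : z ∈ K.khZ (k + l) (2 * k + c)),
    ∃ h : z ∈ K.ssZ c 1 k (k + l), e₁ k l (P.π 1 zero_le_one k l ⟨z, h⟩) = cls _ _ z hz
  e₁_diff : ∀ k l ξ, e₁ (k + 1) l ((E.page 1).d (k, l) (k + 1, l) ξ) =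
    K.betaStar (k + l) (2 * k + c) (k + 1 + l) (2 * (k + 1) + c) (e₁ k l ξ)
  e₂ (k l : ℤ) : (E.page 2).X (k, l) ≃ₗ[F2] K.Sec (k + l) (2 * k + c)
  e₂_cls : ∀ k l (z : K.V) (h₁ : z ∈ K.ssZ c 1 k (k + l)) (h₂ : z ∈ K.ssZ c 2 k (k + l)),
    ∃ h : e₁ k l (P.π 1 zero_le_one k l ⟨z, h₁⟩) ∈ K.secZ (k + l) (2 * k + c),
      e₂ k l (P.π 2 zero_le_two k l ⟨z, h₂⟩) = cls _ _ _ h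

end Theory

end BarNatan

/-!
# The spectral sequence from Khovanov homology to filtered Bar-Natan homology

The proof has a topological half, about the cube of smoothings, and an algebraic half, about
bigraded complexes. They meet in `Theory.IsBigradedComplex`: a finite-dimensional bigraded vector
space with `d = ∂ + β`, `d ∘ d = 0`, where `∂` and `β` have bidegrees `(1, 0)` and `(1, 2)` and
the `q`-degrees have constant parity.

*Planarity.* Euler's formula says that the diagram lies on spheres, so `H¹` over `F2` vanishes
for the cell decomposition dual to the diagram. The constant function `1` on edges, which is a
cocycle because the graph is 4-valent, is therefore a coboundary: the faces have a chequerboard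
colouring, equivalently the edges have an orientation that alternates around each crossing
(`LinkDiagram.exists_isAlternating`). With it, the circles of every smoothing are the cycles of a
permutation, and changing a crossing multiplies this permutation by a transposition. Hence every
edge of the cube merges two circles or splits one (`LinkDiagram.isSaddle`), and the number of
circles changes parity along it. The same argument with the given orientation compares the
Seifert circles with the components of the link, which yields the parity of the `q`-degree
(`LinkDiagram.exists_qdeg_eq`).

*The equation `d ∘ d = 0`.* The algebra `F2[x] / (x² = x)` is spanned by the orthogonal
idempotents `x` and `1 + x`, on which `Δ` is `e ↦ e ⊗ e`. A tensor product of idempotents over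
the circles of a smoothing is therefore sent along an edge of the cube to the tensor product with
the same labels, or to zero if two different labels meet (`LinkDiagram.edgeMap_idem`). So the two
ways around a square of the cube agree, and their sum vanishes in characteristic two. The
equations `∂ ∘ ∂ = 0`, `∂ ∘ β + β ∘ ∂ = 0` and `β ∘ β = 0` are the homogeneous parts of `d ∘ d =
0`.

*The reduced theory.* The image of `x` is spanned by the states with label `x` at the base point,
which all three maps preserve; the other states are coordinates on the quotient.

*The spectral sequence.* It is the classical one, `E_r = Z_r / (Z_{r-1} + d Z_{r-1})`. The
elements of `Z_{r+1}` map onto the kernel of `d_r`, and those that represent boundaries of `d_r`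
are the denominator of `E_{r+1}`; this identifies the homology of each page with the next. The
first pages are computed by taking the component of lowest `q`-degree, and convergence holds
because the filtration is finite.
-/

namespace BarNatan

/-! ### Permutations multiplied by a transposition -/

/-- Multiplying by a transposition joins two different cycles. -/
theorem sameCycle_mul_swap_of_not {P : Type*} [Finite P] [DecidableEq P] (σ : Equiv.Perm P)
    {a b : P} (h : ¬ σ.SameCycle a b) : (σ * Equiv.swap a b).SameCycle a b := by
  set τ := σ * Equiv.swap a b with hτ
  have hex : ∃ m, 0 < m ∧ (σ ^ m) a = a :=
    ⟨orderOf σ, (isOfFinOrder_of_finite σ).orderOf_pos, by rw [pow_orderOf_eq_one]; rfl⟩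
  classical
  obtain ⟨hm, hma⟩ := Nat.find_spec hex
  set m := Nat.find hex with hmdef
  -- `τ` sends `b` to `σ a` and then follows the cycle of `a` under `σ` until it returns to `a`.
  have key : ∀ i, i + 1 ≤ m → τ.SameCycle b ((σ ^ (i + 1)) a) := by
    intro i
    induction i with
    | zero =>
      intro _
      have : τ b = σ a := by simp [hτ]
      rw [zero_add, pow_one, ← this]
      exact (Equiv.Perm.sameCycle_apply_right).2 (Equiv.Perm.SameCycle.refl _ _)
    | succ i ih =>
      intro hi
      have h1 := ih (by omega)
      have hna : (σ ^ (i + 1)) a ≠ a := fun h2 =>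
        Nat.find_min hex (m := i + 1) (by omega) ⟨by omega, h2⟩
      have hnb : (σ ^ (i + 1)) a ≠ b := fun h2 =>
        h ⟨((i + 1 : ℕ) : ℤ), by rwa [zpow_natCast]⟩
      have : τ ((σ ^ (i + 1)) a) = (σ ^ (i + 1 + 1)) a := by
        rw [hτ, Equiv.Perm.mul_apply, Equiv.swap_apply_of_ne_of_ne hna hnb, pow_succ' σ (i + 1),
          Equiv.Perm.mul_apply]
      rw [← this]
      exact (Equiv.Perm.sameCycle_apply_right).2 h1
  have h2 := key (m - 1) (by omega)
  rw [Nat.sub_add_cancel hm, hma] at h2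
  exact h2.symm

/-- Multiplying by a transposition cuts a cycle that contains both points. -/
theorem not_sameCycle_mul_swap {P : Type*} [Finite P] [DecidableEq P] (σ : Equiv.Perm P)
    {a b : P} (hab : a ≠ b) (h : σ.SameCycle a b) : ¬ (σ * Equiv.swap a b).SameCycle a b := by
  set τ := σ * Equiv.swap a b with hτ
  have hex : ∃ k, 0 < k ∧ (σ ^ k) a = b := by
    obtain ⟨i, hi0, -, hi⟩ := h.exists_pow_eq''
    exact ⟨i, hi0, hi⟩
  classical
  obtain ⟨hk, hkb⟩ := Nat.find_spec hex
  set k := Nat.find hex with hkdef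
  have hmin : ∀ i, 0 < i → i < k → (σ ^ i) a ≠ b := fun i h0 h1 h2 =>
    Nat.find_min hex h1 ⟨h0, h2⟩
  have hna : ∀ i, 0 < i → i ≤ k → (σ ^ i) a ≠ a := by
    intro i h0 h1 h2
    rcases h1.eq_or_lt with rfl | h1
    · exact hab (h2.symm.trans hkb)
    · refine hmin (k - i) (by omega) (by omega) ?_
      rw [← hkb]
      conv_rhs => rw [← Nat.sub_add_cancel h1.le, pow_add, Equiv.Perm.mul_apply, h2]
  -- The cycle of `b` under `τ` stays on the arc `σ a, …, σ ^ k a = b`, which misses `a`.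
  have key : ∀ j : ℕ, ∃ i, 0 < i ∧ i ≤ k ∧ (τ ^ j) b = (σ ^ i) a := by
    intro j
    induction j with
    | zero => exact ⟨k, hk, le_rfl, by simp [hkb]⟩
    | succ j ih =>
      obtain ⟨i, h0, h1, h2⟩ := ih
      rw [pow_succ', Equiv.Perm.mul_apply, h2]
      rcases h1.eq_or_lt with rfl | h1
      · exact ⟨1, one_pos, hk, by rw [hkb]; simp [hτ]⟩
      · refine ⟨i + 1, by omega, h1, ?_⟩
        rw [hτ, Equiv.Perm.mul_apply, Equiv.swap_apply_of_ne_of_ne (hna i h0 h1.le)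
          (hmin i h0 h1), pow_succ' σ i, Equiv.Perm.mul_apply]
  intro h'
  obtain ⟨j, -, -, hj⟩ := h'.symm.exists_pow_eq''
  obtain ⟨i, h0, h1, h2⟩ := key j
  exact hna i h0 h1 (h2.symm.trans hj)

/-- Only the cycles through `a` and `b` are affected by the transposition of `a` and `b`. -/
theorem sameCycle_mul_swap_or {P : Type*} [Finite P] [DecidableEq P] (σ : Equiv.Perm P)
    {a b p q : P} (h : σ.SameCycle p q) :
    (σ * Equiv.swap a b).SameCycle p q ∨
      ((σ * Equiv.swap a b).SameCycle p a ∨ (σ * Equiv.swap a b).SameCycle p b) ∧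
      ((σ * Equiv.swap a b).SameCycle q a ∨ (σ * Equiv.swap a b).SameCycle q b) := by
  set τ := σ * Equiv.swap a b with hτ
  obtain ⟨j, -, -, rfl⟩ := h.exists_pow_eq''
  clear h
  induction j with
  | zero => exact .inl (Equiv.Perm.SameCycle.refl _ _)
  | succ j ih =>
    rw [pow_succ', Equiv.Perm.mul_apply]
    set q := (σ ^ j) p
    by_cases hqa : q = a
    · have h1 : τ b = σ q := by simp [hτ, hqa]
      have h2 : τ.SameCycle (σ q) b := by
        rw [← h1]; exact (Equiv.Perm.sameCycle_apply_left).2 (Equiv.Perm.SameCycle.refl _ _)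
      rcases ih with ih | ih
      · exact .inr ⟨.inl (hqa ▸ ih), .inr h2⟩
      · exact .inr ⟨ih.1, .inr h2⟩
    by_cases hqb : q = b
    · have h1 : τ a = σ q := by simp [hτ, hqb]
      have h2 : τ.SameCycle (σ q) a := by
        rw [← h1]; exact (Equiv.Perm.sameCycle_apply_left).2 (Equiv.Perm.SameCycle.refl _ _)
      rcases ih with ih | ih
      · exact .inr ⟨.inr (hqb ▸ ih), .inl h2⟩
      · exact .inr ⟨ih.1, .inl h2⟩
    · have h1 : τ q = σ q := by
        rw [hτ, Equiv.Perm.mul_apply, Equiv.swap_apply_of_ne_of_ne hqa hqb]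
      rw [← h1]
      simpa only [Equiv.Perm.sameCycle_apply_right, Equiv.Perm.sameCycle_apply_left] using ih

/-- Two partitions of a set `P`, given by the surjections `π` and `π'` onto the sets of their
parts, are related by a saddle at `a` and `b`: outside the parts of `a` and `b` they agree, and
`a` and `b` lie in one part of exactly one of them. -/
structure IsSaddle {P C C' : Type*} (π : P → C) (π' : P → C') (a b : P) : Prop where
  surj : Function.Surjective π
  surj' : Function.Surjective π'
  imp : ∀ p q, π p = π q → π' p = π' q ∨
    (π' p = π' a ∨ π' p = π' b) ∧ (π' q = π' a ∨ π' q = π' b)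
  imp' : ∀ p q, π' p = π' q → π p = π q ∨ (π p = π a ∨ π p = π b) ∧ (π q = π a ∨ π q = π b)
  iff : π' a = π' b ↔ π a ≠ π b

theorem isSaddle_of_sameCycle {P C C' : Type*} [Finite P] [DecidableEq P] {π : P → C} {π' : P → C'}
    {σ : Equiv.Perm P} {a b : P} (hab : a ≠ b) (hπ : Function.Surjective π)
    (hπ' : Function.Surjective π')
    (h : ∀ p q, π p = π q ↔ σ.SameCycle p q)
    (h' : ∀ p q, π' p = π' q ↔ (σ * Equiv.swap a b).SameCycle p q) : IsSaddle π π' a b where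
  surj := hπ
  surj' := hπ'
  imp p q := by simpa only [h, h'] using sameCycle_mul_swap_or σ
  imp' p q := by
    simpa only [h, h', mul_assoc, Equiv.swap_mul_self, mul_one] using
      sameCycle_mul_swap_or (σ * Equiv.swap a b) (a := a) (b := b) (p := p) (q := q)
  iff := by
    rw [ne_eq, h, h']
    exact ⟨fun h1 h2 => not_sameCycle_mul_swap σ hab h2 h1, sameCycle_mul_swap_of_not σ⟩

open Classical in
theorem sum_sub_ite {C M : Type*} [Fintype C] [AddCommGroup M] (F : C → M) (u v : C) :
    (∑ c, F c) - (if u = v then F u else F u + F v) =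
      ∑ c ∈ Finset.univ.filter (fun c => ¬ (c = u ∨ c = v)), F c := by
  rw [sub_eq_iff_eq_add,
    ← Finset.sum_filter_not_add_sum_filter Finset.univ (fun c => c = u ∨ c = v)]
  congr 1
  have : Finset.univ.filter (fun c => c = u ∨ c = v) = {u, v} := by ext; simp
  rw [this]
  split_ifs with huv
  · subst huv; simp
  · rw [Finset.sum_pair huv]

namespace IsSaddle

variable {P C C' : Type*} {π : P → C} {π' : P → C'} {a b : P}

theorem symm (h : IsSaddle π π' a b) : IsSaddle π' π a b :=
  ⟨h.surj', h.surj, h.imp', h.imp, by rw [ne_eq, h.iff]; tauto⟩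

theorem mem (h : IsSaddle π π' a b) {p : P} (hp : π p = π a ∨ π p = π b) :
    π' p = π' a ∨ π' p = π' b := by
  rcases hp with hp | hp
  · rcases h.imp _ _ hp with h1 | h1
    exacts [.inl h1, h1.1]
  · rcases h.imp _ _ hp with h1 | h1
    exacts [.inr h1, h1.1]

theorem mem_iff (h : IsSaddle π π' a b) {p : P} :
    (π p = π a ∨ π p = π b) ↔ (π' p = π' a ∨ π' p = π' b) :=
  ⟨h.mem, h.symm.mem⟩

theorem eq_of_eq (h : IsSaddle π π' a b) {p q : P} (hp : ¬ (π p = π a ∨ π p = π b))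
    (hpq : π p = π q) : π' p = π' q := by
  rcases h.imp _ _ hpq with h1 | h1
  · exact h1
  · exact absurd (h.mem_iff.2 h1.1) hp

open Classical in
/-- A sum over the parts of a partition changes under a saddle by the terms at `a` and `b` only. -/
theorem sum_sub_eq (h : IsSaddle π π' a b) [Fintype C] [Fintype C'] {M : Type*} [AddCommGroup M]
    (F : C → M) (G : C' → M)
    (hFG : ∀ p, ¬ (π p = π a ∨ π p = π b) → F (π p) = G (π' p)) :
    (∑ c, F c) - (if π a = π b then F (π a) else F (π a) + F (π b)) =
      (∑ c, G c) - (if π' a = π' b then G (π' a) else G (π' a) + G (π' b)) := by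
  rw [sum_sub_ite F, sum_sub_ite G]
  obtain ⟨s, hs⟩ := h.surj.hasRightInverse
  refine Finset.sum_bij (fun c _ => π' (s c)) ?_ ?_ ?_ ?_
  · intro c hc
    rw [Finset.mem_filter] at hc ⊢
    refine ⟨Finset.mem_univ _, fun hc' => hc.2 ?_⟩
    simpa [hs c] using h.mem_iff.2 hc'
  · intro c hc c' hc' heq
    rw [Finset.mem_filter] at hc
    have := h.symm.eq_of_eq (p := s c) (q := s c')
      (fun h' => hc.2 (by simpa [hs c] using h.mem_iff.2 h')) heq
    rwa [hs, hs] at this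
  · intro c' hc'
    rw [Finset.mem_filter] at hc'
    obtain ⟨p, rfl⟩ := h.surj' c'
    have hp : ¬ (π p = π a ∨ π p = π b) := fun h' => hc'.2 (h.mem h')
    refine ⟨π p, by simpa using hp, ?_⟩
    exact (h.eq_of_eq hp (hs (π p)).symm).symm
  · intro c hc
    rw [Finset.mem_filter] at hc
    rw [← hFG (s c) (by rw [hs]; exact hc.2), hs]

/-- The number of parts changes parity under a saddle. -/
theorem card_add_one (h : IsSaddle π π' a b) [Finite C] [Finite C'] :
    (Nat.card C' : ZMod 2) = Nat.card C + 1 := by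
  have := Fintype.ofFinite C
  have := Fintype.ofFinite C'
  have h1 := h.sum_sub_eq (M := ZMod 2) (fun _ => 1) (fun _ => 1) fun _ _ => rfl
  have h3 := h.iff
  rw [Finset.sum_const, Finset.sum_const, Finset.card_univ, Finset.card_univ, nsmul_one,
    nsmul_one] at h1
  rw [Nat.card_eq_fintype_card, Nat.card_eq_fintype_card]
  generalize (Fintype.card C : ZMod 2) = u at h1 ⊢
  generalize (Fintype.card C' : ZMod 2) = v at h1 ⊢
  by_cases hab : π a = π b
  · rw [if_pos hab, if_neg (by tauto)] at h1
    revert h1; revert u v; decide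
  · rw [if_neg hab, if_pos (by tauto)] at h1
    revert h1; revert u v; decide

end IsSaddle

/-! ### Resolutions of crossings and the number of closed curves -/

/-- The classes of a relation are the cycles of a permutation `σ` if `σ` moves along the relation
and related points lie in one cycle. -/
theorem quot_eq_iff_sameCycle {P : Type*} {R : P → P → Prop} {σ : Equiv.Perm P}
    (h₁ : ∀ p, Quot.mk R p = Quot.mk R (σ p)) (h₂ : ∀ p q, R p q → σ.SameCycle p q) (p q : P) :
    Quot.mk R p = Quot.mk R q ↔ σ.SameCycle p q := by
  constructor
  · intro h
    have := Quot.eqvGen_exact h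
    clear h
    induction this with
    | rel p q h => exact h₂ p q h
    | refl => exact Equiv.Perm.SameCycle.refl _ _
    | symm _ _ _ ih => exact ih.symm
    | trans _ _ _ _ _ ih ih' => exact ih.trans ih'
  · rintro ⟨k, rfl⟩
    have hs : ∀ p, Quot.mk R (σ⁻¹ p) = Quot.mk R p := fun p => by simpa using h₁ (σ⁻¹ p)
    induction k with
    | zero => rfl
    | succ k ih => rw [add_comm, zpow_add, zpow_one, Equiv.Perm.mul_apply, ← h₁, ← ih]
    | pred k ih =>
      rw [sub_eq_neg_add, zpow_add, zpow_neg_one, Equiv.Perm.mul_apply, hs, ← ih]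

namespace LinkDiagram

/-- A way to join up the half-edges at each crossing, coherent with an orientation `o` of the
edges, where `o a` means that `a` is directed away from its crossing. -/
structure IsCoherent (D : LinkDiagram) (o : Dart D.n → Bool) (m : Fin D.n → Fin 4 → Fin 4) :
    Prop where
  invol : ∀ x i, m x (m x i) = i
  glue : ∀ a, o (D.glue a) = !o a
  cross : ∀ x i, o (x, m x i) = !o (x, i)

/-- Running along the closed curves that `m` produces, in the direction given by `o`. Crossingless
circles are fixed points. -/
def run (D : LinkDiagram) {o : Dart D.n → Bool} {m : Fin D.n → Fin 4 → Fin 4}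
    (h : D.IsCoherent o m) : Equiv.Perm D.Point :=
  Equiv.sumCongr
    { toFun := fun a => if o a then D.glue a else (a.1, m a.1 a.2)
      invFun := fun a => if o a then (a.1, m a.1 a.2) else D.glue a
      left_inv := fun a => by
        by_cases ha : o a = true
        · simp [ha, h.glue, D.glue_glue]
        · rw [Bool.not_eq_true] at ha
          have := h.cross a.1 a.2
          rw [Prod.mk.eta, ha] at this
          simp [ha, this, h.invol]
      right_inv := fun a => by
        by_cases ha : o a = true
        · have := h.cross a.1 a.2
          rw [Prod.mk.eta, ha] at this
          simp [ha, this, h.invol]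
        · rw [Bool.not_eq_true] at ha
          simp [ha, h.glue, D.glue_glue] }
    (Equiv.refl _)

theorem run_inl (D : LinkDiagram) {o : Dart D.n → Bool} {m : Fin D.n → Fin 4 → Fin 4}
    (h : D.IsCoherent o m) (a : Dart D.n) :
    D.run h (.inl a) = .inl (if o a then D.glue a else (a.1, m a.1 a.2)) := rfl

theorem mk_eq_iff_run (D : LinkDiagram) {o : Dart D.n → Bool} {m : Fin D.n → Fin 4 → Fin 4}
    (h : D.IsCoherent o m) {R : D.Point → D.Point → Prop}
    (hR : ∀ p q, R p q ↔ ∃ a, p = .inl a ∧ (q = .inl (D.glue a) ∨ q = .inl (a.1, m a.1 a.2)))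
    (p q : D.Point) : Quot.mk R p = Quot.mk R q ↔ (D.run h).SameCycle p q := by
  apply quot_eq_iff_sameCycle
  · rintro (a | f)
    · apply Quot.sound
      rw [hR, run_inl]
      refine ⟨a, rfl, ?_⟩
      split_ifs
      exacts [.inl rfl, .inr rfl]
    · rfl
  · intro p q hpq
    obtain ⟨a, rfl, hq⟩ := (hR p q).1 hpq
    have key : ∀ a b : Dart D.n, D.run h (.inl a) = .inl b →
        (D.run h).SameCycle (.inl a) (.inl b) :=
      fun a b hab => by
        rw [← hab, Equiv.Perm.sameCycle_apply_right]
    by_cases ha : o a = true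
    · rcases hq with rfl | rfl
      · exact key _ _ (by rw [run_inl, if_pos ha])
      · refine (key _ _ ?_).symm
        have := h.cross a.1 a.2
        rw [Prod.mk.eta, ha] at this
        rw [run_inl, if_neg (by simp [this]), h.invol]
    · rcases hq with rfl | rfl
      · refine (key _ _ ?_).symm
        rw [run_inl, h.glue, if_pos (by simpa using ha), D.glue_glue]
      · exact key _ _ (by rw [run_inl, if_neg ha])

/-- Exchanging the successors of the two incoming half-edges at one crossing is a saddle. -/
theorem isSaddle_of_exchange (D : LinkDiagram) {o : Dart D.n → Bool}
    {m m' : Fin D.n → Fin 4 → Fin 4} (h : D.IsCoherent o m) (h' : D.IsCoherent o m')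
    {R R' : D.Point → D.Point → Prop}
    (hR : ∀ p q, R p q ↔ ∃ a, p = .inl a ∧ (q = .inl (D.glue a) ∨ q = .inl (a.1, m a.1 a.2)))
    (hR' : ∀ p q, R' p q ↔ ∃ a, p = .inl a ∧ (q = .inl (D.glue a) ∨ q = .inl (a.1, m' a.1 a.2)))
    (x : Fin D.n) {i j : Fin 4} (hij : i ≠ j) (ho : ∀ k, o (x, k) = false → k = i ∨ k = j)
    (hi : m' x i = m x j) (hj : m' x j = m x i) (hne : ∀ y, y ≠ x → m' y = m y)
    (oi : o (x, i) = false) (oj : o (x, j) = false) :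
    IsSaddle (Quot.mk R) (Quot.mk R') (.inl (x, i)) (.inl (x, j)) := by
  classical
  refine isSaddle_of_sameCycle (σ := D.run h) (by simpa using hij) Quot.mk_surjective
    Quot.mk_surjective (D.mk_eq_iff_run h hR) fun p q => ?_
  rw [D.mk_eq_iff_run h' hR']
  suffices D.run h' = D.run h * Equiv.swap (.inl (x, i)) (.inl (x, j)) by rw [this]
  ext1 p
  rw [Equiv.Perm.mul_apply]
  by_cases hpi : p = .inl (x, i)
  · subst hpi
    rw [Equiv.swap_apply_left, run_inl, run_inl, if_neg (by simp [oi]), if_neg (by simp [oj]), hi]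
  by_cases hpj : p = .inl (x, j)
  · subst hpj
    rw [Equiv.swap_apply_right, run_inl, run_inl, if_neg (by simp [oj]), if_neg (by simp [oi]), hj]
  rw [Equiv.swap_apply_of_ne_of_ne hpi hpj]
  rcases p with a | f
  · rw [run_inl, run_inl]
    by_cases ha : o a = true
    · rw [if_pos ha, if_pos ha]
    · rw [if_neg ha, if_neg ha]
      by_cases hx : a.1 = x
      · obtain ⟨y, k⟩ := a
        obtain rfl : y = x := hx
        rcases ho k (by simpa using ha) with rfl | rfl
        · exact absurd rfl hpi
        · exact absurd rfl hpj
      · rw [hne _ hx]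
  · rfl

theorem touch_iff (D : LinkDiagram) (α : D.Smoothing) (p q : D.Point) : D.Touch α p q ↔
    ∃ a, p = .inl a ∧ (q = .inl (D.glue a) ∨ q = .inl (a.1, partner (α a.1) a.2)) := by
  constructor
  · rintro (a | a)
    exacts [⟨a, rfl, .inl rfl⟩, ⟨a, rfl, .inr rfl⟩]
  · rintro ⟨a, rfl, rfl | rfl⟩
    exacts [.edge a, .smooth a]

theorem along_iff (D : LinkDiagram) (p q : D.Point) : D.Along p q ↔
    ∃ a, p = .inl a ∧ (q = .inl (D.glue a) ∨ q = .inl (a.1, a.2 + 2)) := by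
  constructor
  · rintro (a | a)
    exacts [⟨a, rfl, .inl rfl⟩, ⟨a, rfl, .inr rfl⟩]
  · rintro ⟨a, rfl, rfl | rfl⟩
    exacts [.edge a, .cross a]

theorem partner_partner (b : Bool) (i : Fin 4) : partner b (partner b i) = i := by
  revert b i; decide

/-- An orientation of the edges that alternates between outgoing and incoming around each
crossing.  A chequerboard colouring of the faces induces one: black faces lie on the left. -/
structure IsAlternating (D : LinkDiagram) (t : Dart D.n → Bool) : Prop where
  rot : ∀ a, t (rot a) = !t a
  glue : ∀ a, t (D.glue a) = !t a

namespace IsAlternating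

variable {D : LinkDiagram} {t : Dart D.n → Bool}

theorem not (h : D.IsAlternating t) : D.IsAlternating fun a => !t a :=
  ⟨fun a => by rw [h.rot], fun a => by rw [h.glue]⟩

/-- Both smoothings join adjacent half-edges, so they respect an alternating orientation. -/
theorem isCoherent (h : D.IsAlternating t) (α : D.Smoothing) :
    D.IsCoherent t fun x => partner (α x) where
  invol x i := partner_partner _ i
  glue := h.glue
  cross x i := by
    have h0 : t (x, 1) = !t (x, 0) := h.rot (x, 0)
    have h1 : t (x, 2) = !t (x, 1) := h.rot (x, 1)
    have h2 : t (x, 3) = !t (x, 2) := h.rot (x, 2)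
    generalize α x = b
    fin_cases i <;> cases b <;> simp_all [partner]

theorem isSaddle (h : D.IsAlternating t) {α : D.Smoothing} {x : Fin D.n} (hx : α x = false) :
    IsSaddle (D.circle α) (D.circle (Function.update α x true)) (.inl (x, 0)) (.inl (x, 2)) := by
  -- Reversing `t` if necessary, the half-edges `0` and `2` are the incoming ones at `x`.
  wlog ht : t (x, 0) = false generalizing t
  · exact this h.not (by simpa using ht)
  have h0 : t (x, 1) = !t (x, 0) := h.rot (x, 0)
  have h1 : t (x, 2) = !t (x, 1) := h.rot (x, 1)
  have h2 : t (x, 3) = !t (x, 2) := h.rot (x, 2)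
  rw [ht] at h0; rw [h0] at h1; rw [h1] at h2
  refine D.isSaddle_of_exchange (h.isCoherent α) (h.isCoherent _) (D.touch_iff α) (D.touch_iff _) x
    (by decide) ?_ ?_ ?_ ?_ ht h1
  · intro k hk
    fin_cases k <;> simp_all
  · simp [hx, partner]
  · simp [hx, partner]
  · intro y hy
    simp [hy]

/-- Changing smoothings changes the parity of the number of circles. -/
theorem card_circle_add (h : D.IsAlternating t) (s : Finset (Fin D.n)) :
    (Nat.card (D.Circle fun x => decide (x ∈ s)) : ZMod 2) + s.card =
      Nat.card (D.Circle fun _ => false) := by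
  induction s using Finset.induction_on with
  | empty => simp
  | insert x s hx ih =>
    have h1 := (h.isSaddle (α := fun x => decide (x ∈ s)) (x := x) (by simpa using hx)).card_add_one
    have h2 : Function.update (fun x => decide (x ∈ s)) x true =
        fun y => decide (y ∈ insert x s) := by
      ext y
      by_cases hy : y = x
      · subst hy; simp
      · simp [hy]
    rw [h2] at h1
    rw [h1, Finset.card_insert_of_notMem hx, ← ih]
    push_cast
    linear_combination (CharTwo.two_eq_zero : (2 : ZMod 2) = 0)

end IsAlternating

instance (D : LinkDiagram) : Finite D.Component := inferInstanceAs (Finite (Quot D.Along))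

/-- Seifert smoothing at the crossings in `s`, and passing straight on at the others. -/
def seifertJoin (D : LinkDiagram) (s : Finset (Fin D.n)) (x : Fin D.n) (i : Fin 4) : Fin 4 :=
  if x ∈ s then partner (!D.positive x) i else i + 2

theorem isCoherent_seifertJoin (D : LinkDiagram) (s : Finset (Fin D.n)) :
    D.IsCoherent (isOut D.positive) (D.seifertJoin s) where
  invol x i := by
    unfold seifertJoin
    split_ifs
    · exact partner_partner _ i
    · revert i; decide
  glue := D.orient
  cross x i := by
    unfold seifertJoin isOut
    dsimp only
    generalize D.positive x = b
    split_ifs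
    · revert i b; decide
    · revert i b; decide

/-- The relation whose classes are the closed curves of `D.seifertJoin s`. -/
def SeifertTouch (D : LinkDiagram) (s : Finset (Fin D.n)) (p q : D.Point) : Prop :=
  ∃ a, p = .inl a ∧ (q = .inl (D.glue a) ∨ q = .inl (a.1, D.seifertJoin s a.1 a.2))

/-- Each Seifert smoothing changes the parity of the number of closed curves. -/
theorem card_seifertTouch (D : LinkDiagram) (s : Finset (Fin D.n)) :
    (Nat.card (Quot (D.SeifertTouch s)) : ZMod 2) = Nat.card D.Component + s.card := by
  induction s using Finset.induction_on with
  | empty =>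
    -- Going straight on everywhere gives the components of the link.
    have : D.SeifertTouch ∅ = D.Along := by
      ext p q
      rw [along_iff]
      simp [SeifertTouch, seifertJoin]
    rw [this, Finset.card_empty, Nat.cast_zero, add_zero]
    rfl
  | insert x s hx ih =>
    have h1 : IsSaddle (Quot.mk (D.SeifertTouch s)) (Quot.mk (D.SeifertTouch (insert x s)))
        (.inl (x, 0)) (.inl (x, if D.positive x then 3 else 1)) := by
      refine D.isSaddle_of_exchange (D.isCoherent_seifertJoin s) (D.isCoherent_seifertJoin _)
        (fun _ _ => Iff.rfl) (fun _ _ => Iff.rfl) x ?_ ?_ ?_ ?_ ?_ ?_ ?_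
      · split_ifs <;> decide
      · unfold isOut
        dsimp only
        generalize D.positive x = b
        revert b; decide
      · simp only [seifertJoin, Finset.mem_insert_self, hx, if_true, if_false]
        generalize D.positive x = b
        revert b; decide
      · simp only [seifertJoin, Finset.mem_insert_self, hx, if_true, if_false]
        generalize D.positive x = b
        revert b; decide
      · intro y hy
        ext i
        simp [seifertJoin, Finset.mem_insert, hy]
      · rfl
      · unfold isOut
        dsimp only
        generalize D.positive x = b
        revert b; decide
    rw [h1.card_add_one, ih, Finset.card_insert_of_notMem hx]
    push_cast
    ring

/-- The number of Seifert circles has the parity of the number of components plus the number of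
crossings. -/
theorem card_circle_seifert (D : LinkDiagram) :
    (Nat.card (D.Circle fun x => !D.positive x) : ZMod 2) = Nat.card D.Component + D.n := by
  have h := D.card_seifertTouch Finset.univ
  have : D.SeifertTouch Finset.univ = D.Touch fun x => !D.positive x := by
    ext p q
    rw [touch_iff]
    simp [SeifertTouch, seifertJoin]
  rw [this, Finset.card_univ, Fintype.card_fin] at h
  exact h

/-! ### Planar diagrams have alternating orientations -/

instance (D : LinkDiagram) : Finite (Face D.glue) :=
  inferInstanceAs (Finite (Quot fun a b : Dart D.n => b = rot (D.glue a)))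

instance (D : LinkDiagram) : Finite (Piece D.glue) :=
  inferInstanceAs (Finite (Quot fun a b : Dart D.n => b = D.glue a ∨ b = rot a))

/-- The edges of the diagram, each represented by its outgoing half. -/
abbrev Edge (D : LinkDiagram) : Type := {a : Dart D.n // isOut D.positive a = true}

/-- The face to the left of a half-edge directed away from its crossing. -/
def face (D : LinkDiagram) (a : Dart D.n) : Face D.glue := Quot.mk _ a

/-- The connected piece that contains a half-edge. -/
def piece (D : LinkDiagram) (a : Dart D.n) : Piece D.glue := Quot.mk _ a

theorem face_rot (D : LinkDiagram) (a : Dart D.n) : D.face (rot a) = D.face (D.glue a) := by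
  refine (Quot.sound ?_).symm
  rw [D.glue_glue]

theorem piece_glue (D : LinkDiagram) (a : Dart D.n) : D.piece (D.glue a) = D.piece a :=
  (Quot.sound (.inl rfl)).symm

theorem piece_rot (D : LinkDiagram) (a : Dart D.n) : D.piece (rot a) = D.piece a :=
  (Quot.sound (.inr rfl)).symm

theorem eq_piece_of_invariant {M : Type*} (D : LinkDiagram) (f : Dart D.n → M)
    (h₁ : ∀ a, f (D.glue a) = f a) (h₂ : ∀ a, f (rot a) = f a) :
    ∃ g : Piece D.glue → M, ∀ a, f a = g (D.piece a) :=
  ⟨Quot.lift f fun a b hab => by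
    rcases hab with rfl | rfl
    exacts [(h₁ a).symm, (h₂ a).symm], fun _ => rfl⟩

/-- The coboundary from functions on faces to functions on edges. -/
def faceCoboundary (D : LinkDiagram) : (Face D.glue → F2) →ₗ[F2] (D.Edge → F2) where
  toFun φ a := φ (D.face a.1) + φ (D.face (D.glue a.1))
  map_add' φ ψ := by ext a; simp only [Pi.add_apply]; ring
  map_smul' c φ := by ext a; simp only [Pi.smul_apply, smul_eq_mul, RingHom.id_apply]; ring

/-- The incidence matrix of the underlying graph, modulo 2: both ends of a loop count. -/
def incidence (D : LinkDiagram) : Matrix (Fin D.n) D.Edge F2 :=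
  Matrix.of fun x a => (if a.1.1 = x then 1 else 0) + if (D.glue a.1).1 = x then 1 else 0

theorem isOut_glue_iff (D : LinkDiagram) (a : Dart D.n) :
    isOut D.positive (D.glue a) = true ↔ ¬ isOut D.positive a = true := by
  rw [D.orient]; simp

/-- Gluing exchanges outgoing and incoming half-edges. -/
theorem sum_edge (D : LinkDiagram) {M : Type*} [AddCommMonoid M] (h : Dart D.n → M) :
    ∑ a : D.Edge, (h a.1 + h (D.glue a.1)) = ∑ a, h a := by
  classical
  rw [← Fintype.sum_subtype_add_sum_subtype (fun a => isOut D.positive a = true) h,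
    Finset.sum_add_distrib]
  congr 1
  let e : D.Edge ≃ {a : Dart D.n // ¬ isOut D.positive a = true} :=
    { toFun := fun a => ⟨D.glue a.1, by rw [isOut_glue_iff, not_not]; exact a.2⟩
      invFun := fun a => ⟨D.glue a.1, by rw [isOut_glue_iff]; exact a.2⟩
      left_inv := fun a => Subtype.ext (D.glue_glue _)
      right_inv := fun a => Subtype.ext (D.glue_glue _) }
  exact Fintype.sum_equiv e _ _ fun a => rfl

theorem card_edge (D : LinkDiagram) : Fintype.card D.Edge = 2 * D.n := by
  have h := D.sum_edge (fun _ => (1 : ℕ))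
  simp at h
  omega

/-- A symmetric function `h` on half-edges is a function on edges, and its boundary at `x` is the
sum of its values around `x`. -/
theorem incidence_mulVec (D : LinkDiagram) (h : Dart D.n → F2) (hg : ∀ a, h (D.glue a) = h a)
    (x : Fin D.n) : (D.incidence.mulVec fun a => h a.1) x = ∑ i, h (x, i) := by
  have h1 := D.sum_edge (fun a => (if a.1 = x then 1 else 0) * h a)
  simp only [hg, ← add_mul] at h1
  refine h1.trans ?_
  rw [Fintype.sum_prod_type, Finset.sum_eq_single x]
  · simp
  · intro y _ hy; simp [hy]
  · simp

/-- Only locally constant functions on faces have coboundary zero. -/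
theorem finrank_ker_faceCoboundary_le (D : LinkDiagram) :
    Module.finrank F2 (LinearMap.ker D.faceCoboundary) ≤ Nat.card (Piece D.glue) := by
  have := Fintype.ofFinite (Piece D.glue)
  let q : Face D.glue → Piece D.glue := Quot.lift D.piece fun a b hab => by
    rw [hab, piece_rot, piece_glue]
  have hle : LinearMap.ker D.faceCoboundary ≤ LinearMap.range (LinearMap.funLeft F2 F2 q) := by
    intro φ hφ
    have hg : ∀ a, φ (D.face (D.glue a)) = φ (D.face a) := by
      have key : ∀ a : D.Edge, φ (D.face (D.glue a.1)) = φ (D.face a.1) := fun a =>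
        (CharTwo.add_eq_zero.1 (congrFun hφ a)).symm
      intro a
      by_cases ha : isOut D.positive a = true
      · exact key ⟨a, ha⟩
      · have := key ⟨D.glue a, (D.isOut_glue_iff a).2 ha⟩
        rw [D.glue_glue] at this
        exact this.symm
    obtain ⟨g, hg'⟩ := D.eq_piece_of_invariant (fun a => φ (D.face a)) hg
      fun a => by rw [face_rot, hg]
    refine ⟨g, ?_⟩
    ext f
    obtain ⟨a, rfl⟩ := Quot.exists_rep f
    exact (hg' a).symm
  calc _ ≤ _ := Submodule.finrank_mono hle
    _ ≤ _ := LinearMap.finrank_range_le _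
    _ = _ := by rw [Module.finrank_fintype_fun_eq_card, Nat.card_eq_fintype_card]

/-- The kernel of the transposed incidence matrix consists of the locally constant functions on
crossings. -/
theorem le_rank_incidence (D : LinkDiagram) :
    D.n ≤ D.incidence.rank + Nat.card (Piece D.glue) := by
  have := Fintype.ofFinite (Piece D.glue)
  let q : (Piece D.glue → F2) →ₗ[F2] (Dart D.n → F2) := LinearMap.funLeft F2 F2 D.piece
  let r : (Fin D.n → F2) →ₗ[F2] (Dart D.n → F2) := LinearMap.funLeft F2 F2 Prod.fst
  have hr : Function.Injective r :=
    LinearMap.funLeft_injective_of_surjective _ _ _ fun x => ⟨(x, 0), rfl⟩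
  have hle : (LinearMap.ker D.incidence.transpose.mulVecLin).map r ≤ LinearMap.range q := by
    rintro _ ⟨g, hg, rfl⟩
    have key : ∀ a : D.Edge, g (D.glue a.1).1 = g a.1.1 := fun a => by
      have h1 := congrFun hg a
      rw [Matrix.mulVecLin_apply, Matrix.mulVec_eq_sum] at h1
      simp only [incidence, Finset.sum_apply, Pi.smul_apply, Matrix.transpose_apply,
        Matrix.of_apply, MulOpposite.smul_eq_mul_unop, MulOpposite.unop_op, add_mul,
        ite_mul, one_mul, zero_mul,
        Finset.sum_add_distrib, Finset.sum_ite_eq, Finset.mem_univ, if_true] at h1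
      exact (CharTwo.add_eq_zero.1 h1).symm
    have hg' : ∀ a : Dart D.n, g (D.glue a).1 = g a.1 := by
      intro a
      by_cases ha : isOut D.positive a = true
      · exact key ⟨a, ha⟩
      · have := key ⟨D.glue a, (D.isOut_glue_iff a).2 ha⟩
        rw [D.glue_glue] at this
        exact this.symm
    obtain ⟨f, hf⟩ := D.eq_piece_of_invariant (fun a => g a.1) hg' fun a => rfl
    exact ⟨f, funext fun a => (hf a).symm⟩
  have h1 := (Submodule.finrank_mono hle).trans (LinearMap.finrank_range_le q)
  rw [(Submodule.equivMapOfInjective r hr _).finrank_eq.symm] at h1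
  have h2 := LinearMap.finrank_range_add_finrank_ker D.incidence.transpose.mulVecLin
  have h3 : Module.finrank F2 (LinearMap.range D.incidence.transpose.mulVecLin) =
    D.incidence.rank := Matrix.rank_transpose _
  rw [Module.finrank_fintype_fun_eq_card] at h1 h2
  rw [h3, Fintype.card_fin] at h2
  rw [Nat.card_eq_fintype_card]
  omega

/-- Exactness at the edges: the inclusion is formal, and Euler's formula makes the dimensions
agree. -/
theorem range_faceCoboundary (D : LinkDiagram) :
    LinearMap.range D.faceCoboundary = LinearMap.ker D.incidence.mulVecLin := by
  have := Fintype.ofFinite (Face D.glue)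
  refine Submodule.eq_of_le_of_finrank_le ?_ ?_
  · rintro _ ⟨φ, rfl⟩
    rw [LinearMap.mem_ker]
    ext x
    refine (D.incidence_mulVec (fun a => φ (D.face a) + φ (D.face (D.glue a))) ?_ x).trans ?_
    · intro a
      rw [D.glue_glue, add_comm]
    · simp only [← face_rot]
      simp only [Fin.sum_univ_four, rot]
      have h2 : (2 : F2) = 0 := rfl
      simp only [Fin.isValue, zero_add, Fin.reduceAdd, Pi.zero_apply]
      linear_combination (φ (D.face (x, 0)) + φ (D.face (x, 1)) + φ (D.face (x, 2)) +
        φ (D.face (x, 3))) * h2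
  · have h1 := LinearMap.finrank_range_add_finrank_ker D.faceCoboundary
    have h2 := LinearMap.finrank_range_add_finrank_ker D.incidence.mulVecLin
    have h3 : Module.finrank F2 (LinearMap.range D.incidence.mulVecLin) = D.incidence.rank := rfl
    have h4 := D.finrank_ker_faceCoboundary_le
    have h5 := D.le_rank_incidence
    have h6 := D.planar
    rw [Module.finrank_fintype_fun_eq_card] at h1 h2
    rw [card_edge] at h2
    rw [Nat.card_eq_fintype_card] at h6
    omega

/-- A planar diagram has a chequerboard colouring, hence an alternating orientation. -/
theorem exists_isAlternating (D : LinkDiagram) : ∃ t, D.IsAlternating t := by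
  have h1 : (fun _ => 1) ∈ LinearMap.range D.faceCoboundary := by
    rw [range_faceCoboundary, LinearMap.mem_ker]
    ext x
    refine (D.incidence_mulVec (fun _ => 1) (fun _ => rfl) x).trans ?_
    simp only [Fin.sum_univ_four]
    rfl
  obtain ⟨φ, hφ⟩ := h1
  have key : ∀ a, φ (D.face (D.glue a)) = φ (D.face a) + 1 := by
    have key : ∀ a : D.Edge, φ (D.face a.1) + φ (D.face (D.glue a.1)) = 1 := fun a => congrFun hφ a
    have fin : ∀ u v : F2, u + v = 1 → v = u + 1 := by decide
    intro a
    by_cases ha : isOut D.positive a = true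
    · exact fin _ _ (key ⟨a, ha⟩)
    · have := key ⟨D.glue a, (D.isOut_glue_iff a).2 ha⟩
      rw [D.glue_glue, add_comm] at this
      exact fin _ _ this
  have fin : ∀ u : F2, decide (u + 1 = 0) = !decide (u = 0) := by decide
  refine ⟨fun a => decide (φ (D.face a) = 0), fun a => ?_, fun a => ?_⟩
  · rw [face_rot, key, fin]
  · rw [key, fin]

end LinkDiagram

/-! ### Labels and structure constants -/

instance : DecidableEq Label := fun a b =>
  match a, b with
  | .one, .one => isTrue rfl
  | .x, .x => isTrue rfl
  | .one, .x => isFalse (by simp)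
  | .x, .one => isFalse (by simp)

instance : Fintype Label := ⟨{.one, .x}, fun l => by cases l <;> simp⟩

/-- The `q`-degree of a label. -/
def Label.wt : Label → ℤ
  | .one => 1
  | .x => -1

/-- Operations whose cube map raises the `q`-degree by `δ`; the summand `1` is the contribution
of the new 1-smoothing. -/
structure Ops.HasDegree (O : Ops) (δ : ℤ) : Prop where
  mul : ∀ a b c, O.mul a b c ≠ 0 → c.wt - a.wt - b.wt + 1 = δ
  comul : ∀ a b c, O.comul a b c ≠ 0 → b.wt + c.wt - a.wt + 1 = δ

theorem hasDegree_khOps : khOps.HasDegree 0 := ⟨by decide, by decide⟩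

theorem hasDegree_betaOps : betaOps.HasDegree 2 := ⟨by decide, by decide⟩

/-- Operations for which the tensors with a factor `x` at a given place form an ideal. -/
structure Ops.PreservesX (O : Ops) : Prop where
  mul_left : ∀ b c, O.mul .x b c ≠ 0 → c = .x
  mul_right : ∀ a c, O.mul a .x c ≠ 0 → c = .x
  comul : ∀ b c, O.comul .x b c ≠ 0 → b = .x ∧ c = .x

theorem preservesX_of_mem {O : Ops} (h : O ∈ [khOps, betaOps, bnOps 1]) : O.PreservesX := by
  simp only [List.mem_cons, List.not_mem_nil, or_false] at h
  rcases h with rfl | rfl | rfl <;> exact ⟨by decide, by decide, by decide⟩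

namespace LinkDiagram

/-! ### Bidegrees in the cube of smoothings -/

theorem circle_surjective (D : LinkDiagram) (α : D.Smoothing) :
    Function.Surjective (D.circle α) := Quot.mk_surjective

/-- In a planar diagram, changing a 0-smoothing to a 1-smoothing merges two circles or splits one
circle. -/
theorem isSaddle (D : LinkDiagram) {α : D.Smoothing} {x : Fin D.n} (hx : α x = false) :
    IsSaddle (D.circle α) (D.circle (Function.update α x true)) (.inl (x, 0)) (.inl (x, 2)) :=
  D.exists_isAlternating.choose_spec.isSaddle hx

/-- What a nonzero coefficient along an edge of the cube means: a split with a nonzero coefficient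
of the comultiplication, or a merge with a nonzero coefficient of the multiplication. -/
theorem edgeCoeff_ne_zero {D : LinkDiagram} {O : Ops} {x : Fin D.n} {S T : D.State}
    (h : D.edgeCoeff O x S T ≠ 0) :
    S.1 x = false ∧ T.1 = Function.update S.1 x true ∧
      IsSaddle (D.circle S.1) (D.circle T.1) (.inl (x, 0)) (.inl (x, 2)) ∧
      (∀ p, ¬ (D.circle S.1 p = D.circle S.1 (.inl (x, 0)) ∨
        D.circle S.1 p = D.circle S.1 (.inl (x, 2))) → T.lab p = S.lab p) ∧
      (D.circle S.1 (.inl (x, 0)) = D.circle S.1 (.inl (x, 2)) ∧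
        D.circle T.1 (.inl (x, 0)) ≠ D.circle T.1 (.inl (x, 2)) ∧
        O.comul (S.lab (.inl (x, 0))) (T.lab (.inl (x, 0))) (T.lab (.inl (x, 2))) ≠ 0 ∨
       D.circle S.1 (.inl (x, 0)) ≠ D.circle S.1 (.inl (x, 2)) ∧
        D.circle T.1 (.inl (x, 0)) = D.circle T.1 (.inl (x, 2)) ∧
        O.mul (S.lab (.inl (x, 0))) (S.lab (.inl (x, 2))) (T.lab (.inl (x, 0))) ≠ 0) := by
  unfold edgeCoeff at h
  dsimp only at h
  split_ifs at h with h1 h2 h3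
  · exact absurd rfl h
  · have hs := D.isSaddle h1.1
    rw [← h1.2.1] at hs
    exact ⟨h1.1, h1.2.1, hs, fun p hp => h1.2.2 p (fun h => hp (.inl h)) (fun h => hp (.inr h)),
      .inl ⟨h2, h3, h⟩⟩
  · have hs := D.isSaddle h1.1
    rw [← h1.2.1] at hs
    exact ⟨h1.1, h1.2.1, hs, fun p hp => h1.2.2 p (fun h => hp (.inl h)) (fun h => hp (.inr h)),
      .inr ⟨h2, hs.iff.2 h2, h⟩⟩
  · exact absurd rfl h

theorem State.height_update {D : LinkDiagram} {S T : D.State} {x : Fin D.n} (hx : S.1 x = false)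
    (hT : T.1 = Function.update S.1 x true) : T.height = S.height + 1 := by
  have : (Finset.univ.filter fun y => T.1 y = true) =
      insert x (Finset.univ.filter fun y => S.1 y = true) := by
    ext y
    rw [hT]
    by_cases hy : y = x
    · subst hy; simp
    · simp [hy]
  unfold State.height
  rw [this, Finset.card_insert_of_notMem (by simp [hx])]
  push_cast
  rfl

theorem State.qdeg_eq {D : LinkDiagram} (S : D.State) :
    S.qdeg = (∑ c, (S.2 c).wt) + S.height + D.nPlus - 2 * D.nMinus := by
  unfold State.qdeg
  congr 3

theorem degree_of_edgeCoeff_ne_zero {D : LinkDiagram} {O : Ops} {δ : ℤ} (hO : O.HasDegree δ)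
    {x : Fin D.n} {S T : D.State} (h : D.edgeCoeff O x S T ≠ 0) :
    T.hdeg = S.hdeg + 1 ∧ T.qdeg = S.qdeg + δ := by
  obtain ⟨hx, hT, hs, hoff, hloc⟩ := edgeCoeff_ne_zero h
  have hh := State.height_update hx hT
  refine ⟨by unfold State.hdeg; omega, ?_⟩
  have h1 := hs.sum_sub_eq (fun c => (S.2 c).wt) (fun c => (T.2 c).wt) fun p hp => by
    have := hoff p hp
    unfold State.lab at this
    rw [this]
  rw [State.qdeg_eq, State.qdeg_eq, hh]
  rcases hloc with ⟨h2, h3, h4⟩ | ⟨h2, h3, h4⟩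
  · have h5 := hO.comul _ _ _ h4
    rw [if_pos h2, if_neg h3] at h1
    unfold State.lab at h5
    omega
  · have h5 := hO.mul _ _ _ h4
    rw [if_neg h2, if_pos h3] at h1
    unfold State.lab at h5
    omega

theorem cubeMap_apply (D : LinkDiagram) (O : Ops) (v : D.Chain) (T : D.State) :
    D.cubeMap O v T = ∑ S, (∑ x, D.edgeCoeff O x S T) * v S := rfl

theorem exists_of_cubeMap_ne_zero {D : LinkDiagram} {O : Ops} {v : D.Chain} {T : D.State}
    (h : D.cubeMap O v T ≠ 0) : ∃ x S, D.edgeCoeff O x S T ≠ 0 ∧ v S ≠ 0 := by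
  rw [cubeMap_apply] at h
  obtain ⟨S, -, hS⟩ := Finset.exists_ne_zero_of_sum_ne_zero h
  obtain ⟨x, -, hx⟩ := Finset.exists_ne_zero_of_sum_ne_zero (left_ne_zero_of_mul hS)
  exact ⟨x, S, hx, right_ne_zero_of_mul hS⟩

theorem cubeMap_mem_chainDeg (D : LinkDiagram) {O : Ops} {δ : ℤ} (hO : O.HasDegree δ) {i j : ℤ}
    {v : D.Chain} (hv : v ∈ D.chainDeg i j) : D.cubeMap O v ∈ D.chainDeg (i + 1) (j + δ) := by
  intro T hT
  obtain ⟨x, S, hS, hvS⟩ := exists_of_cubeMap_ne_zero hT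
  obtain ⟨h1, h2⟩ := degree_of_edgeCoeff_ne_zero hO hS
  obtain ⟨h3, h4⟩ := hv S hvS
  exact ⟨by rw [h1, h3], by rw [h2, h4]⟩

theorem cubeMap_bnOps_one (D : LinkDiagram) :
    D.cubeMap (bnOps 1) = D.cubeMap khOps + D.cubeMap betaOps := by
  have hm : ∀ a b c, (bnOps 1).mul a b c = khOps.mul a b c + betaOps.mul a b c := by decide
  have hc : ∀ a b c, (bnOps 1).comul a b c = khOps.comul a b c + betaOps.comul a b c := by decide
  refine LinearMap.ext fun v => funext fun T => ?_
  rw [LinearMap.add_apply, Pi.add_apply, cubeMap_apply, cubeMap_apply, cubeMap_apply,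
    ← Finset.sum_add_distrib]
  refine Finset.sum_congr rfl fun S _ => ?_
  rw [← add_mul, ← Finset.sum_add_distrib]
  congr 1
  refine Finset.sum_congr rfl fun x _ => ?_
  unfold edgeCoeff
  dsimp only
  split_ifs
  · rw [add_zero]
  · exact hc _ _ _
  · exact hm _ _ _
  · rw [add_zero]

/-! ### The parity of the `q`-degree -/

theorem n_eq (D : LinkDiagram) : (D.n : ℤ) = D.nPlus + D.nMinus := by
  unfold nPlus nMinus
  have := Finset.card_filter_add_card_filter_not (s := (Finset.univ : Finset (Fin D.n)))
    (fun x => D.positive x = true)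
  simp only [Bool.not_eq_true, Finset.card_univ, Fintype.card_fin] at this
  rw [← Nat.cast_add, this]

/-- All `q`-degrees have the parity of the number of components: it is constant over the cube, and
can be read off from the Seifert smoothing. -/
theorem exists_qdeg_eq {D : LinkDiagram} (S : D.State) : ∃ k, S.qdeg = 2 * k + D.gamma := by
  obtain ⟨t, ht⟩ := D.exists_isAlternating
  have h1 := ht.card_circle_add (Finset.univ.filter fun x => S.1 x = true)
  have h2 := ht.card_circle_add (Finset.univ.filter fun x => D.positive x = false)
  have e1 : (fun x => decide (x ∈ Finset.univ.filter fun x => S.1 x = true)) = S.1 := by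
    ext x; simp
  have e2 : (fun x => decide (x ∈ Finset.univ.filter fun x => D.positive x = false)) =
      fun x => !D.positive x := by
    ext x; simp
  rw [e1] at h1
  rw [e2, card_circle_seifert] at h2
  have hg : (D.gamma : ZMod 2) = Nat.card D.Component := by
    unfold gamma
    rw [Int.cast_natCast, ZMod.natCast_mod]
  have hw : ((∑ c, (S.2 c).wt : ℤ) : ZMod 2) = Nat.card (D.Circle S.1) := by
    have hl : ∀ l : Label, (l.wt : ZMod 2) = 1 := by decide
    rw [Int.cast_sum]
    simp only [hl, Finset.sum_const, Finset.card_univ, nsmul_one, Nat.card_eq_fintype_card]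
  have hn := congrArg (Int.cast : ℤ → ZMod 2) D.n_eq
  have h3 : (2 : ZMod 2) = 0 := rfl
  -- `h1` and `h2` compare the smoothings of `S` and of Seifert with the all-0 smoothing.
  have key : ((S.qdeg - D.gamma : ℤ) : ZMod 2) = 0 := by
    rw [State.qdeg_eq]
    unfold State.height nPlus nMinus at *
    push_cast at *
    rw [hw, hg, h3]
    generalize (Nat.card D.Component : ZMod 2) = u at *
    linear_combination h1 - h2 + (1 : ZMod 2) * hn +
      (((Finset.univ.filter fun x => D.positive x = true).card : ZMod 2) +
        ((Finset.univ.filter fun x => D.positive x = false).card : ZMod 2)) * h3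
  obtain ⟨k, hk⟩ := (ZMod.intCast_zmod_eq_zero_iff_dvd _ 2).1 key
  exact ⟨k, by push_cast at hk; omega⟩

/-! ### The Bar-Natan differential in the basis of idempotents -/

/-- A labelling of the places of the diagram that is constant on the circles of `α`. -/
def Respects (D : LinkDiagram) (α : D.Smoothing) (ℓ : D.Point → Label) : Prop :=
  ∀ p q, D.circle α p = D.circle α q → ℓ p = ℓ q

theorem respects_iff {D : LinkDiagram} {α : D.Smoothing} {ℓ : D.Point → Label} :
    D.Respects α ℓ ↔ (∀ a, ℓ (.inl a) = ℓ (.inl (D.glue a))) ∧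
      ∀ x i, ℓ (.inl (x, i)) = ℓ (.inl (x, partner (α x) i)) := by
  constructor
  · exact fun h => ⟨fun a => h _ _ (Quot.sound (.edge a)), fun x i =>
      h _ _ (Quot.sound (.smooth (x, i)))⟩
  · rintro ⟨h1, h2⟩ p q h
    have := Quot.eqvGen_exact h
    clear h
    induction this with
    | rel p q h =>
      rcases h with a | a
      exacts [h1 a, h2 a.1 a.2]
    | refl => rfl
    | symm _ _ _ ih => exact ih.symm
    | trans _ _ _ _ _ ih ih' => exact ih.trans ih'

/-- If the ends of a path in a square of the cube respect `ℓ`, so does the middle. -/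
theorem Respects.between {D : LinkDiagram} {α : D.Smoothing} {ℓ : D.Point → Label}
    {x y : Fin D.n} (hxy : x ≠ y) (h : D.Respects α ℓ)
    (h' : D.Respects (Function.update (Function.update α x true) y true) ℓ) :
    D.Respects (Function.update α x true) ℓ := by
  rw [respects_iff] at *
  refine ⟨h.1, fun z i => ?_⟩
  by_cases hz : z = x
  · subst hz
    simpa [hxy] using h'.2 z i
  · simpa [hz] using h.2 z i

open Classical in
/-- The tensor product over the circles of `α` of the idempotents `x` (at the label `x`) and
`1 + x` (at the label `1`) of the algebra `F2[x] / (x² = x)`; zero if `ℓ` does not label the circles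
of `α`. -/
noncomputable def idem (D : LinkDiagram) (α : D.Smoothing) (ℓ : D.Point → Label) : D.Chain :=
  fun S => if S.1 = α ∧ D.Respects α ℓ ∧ ∀ p, ℓ p = .x → S.lab p = .x then 1 else 0

theorem idem_eq_zero {D : LinkDiagram} {α : D.Smoothing} {ℓ : D.Point → Label}
    (h : ¬ D.Respects α ℓ) : D.idem α ℓ = 0 := by
  ext S
  unfold idem
  rw [if_neg (by tauto)]
  rfl

/-- The summand of the cube map for the edges at the crossing `x`. -/
noncomputable def edgeMap (D : LinkDiagram) (O : Ops) (x : Fin D.n) : D.Chain →ₗ[F2] D.Chain :=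
  Matrix.mulVecLin (Matrix.of fun T S : D.State => D.edgeCoeff O x S T)

theorem edgeMap_apply (D : LinkDiagram) (O : Ops) (x : Fin D.n) (v : D.Chain) (T : D.State) :
    D.edgeMap O x v T = ∑ S, D.edgeCoeff O x S T * v S := rfl

theorem cubeMap_eq_sum (D : LinkDiagram) (O : Ops) : D.cubeMap O = ∑ x, D.edgeMap O x := by
  refine LinearMap.ext fun v => funext fun T => ?_
  rw [cubeMap_apply, LinearMap.sum_apply, Finset.sum_apply]
  simp only [edgeMap_apply, Finset.sum_mul]
  exact Finset.sum_comm

open Classical in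
/-- The state on `α` that agrees with `T`, except that the circles through `a` and `b` are
labelled `u` and `v`. -/
noncomputable def fill (D : LinkDiagram) (α : D.Smoothing) (T : D.State) (a b : D.Point)
    (u v : Label) : D.State :=
  ⟨α, fun c => if c = D.circle α a then u else if c = D.circle α b then v else T.lab c.out⟩

section Fill

variable {D : LinkDiagram} {α : D.Smoothing} {T : D.State} {a b : D.Point}

theorem fill_lab_left (u v : Label) : (D.fill α T a b u v).lab a = u := if_pos rfl

theorem fill_lab_right (h : D.circle α a ≠ D.circle α b) (u v : Label) :
    (D.fill α T a b u v).lab b = v := by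
  unfold State.lab fill
  dsimp only
  rw [if_neg h.symm, if_pos rfl]

theorem fill_lab_of_not (hs : IsSaddle (D.circle α) (D.circle T.1) a b) (u v : Label) {p : D.Point}
    (hp : ¬ (D.circle α p = D.circle α a ∨ D.circle α p = D.circle α b)) :
    (D.fill α T a b u v).lab p = T.lab p := by
  rw [not_or] at hp
  have h1 : (D.fill α T a b u v).lab p = T.lab (D.circle α p).out := by
    unfold State.lab fill
    dsimp only
    rw [if_neg hp.1, if_neg hp.2]
    rfl
  have h2 : D.circle α (D.circle α p).out = D.circle α p := Quot.out_eq _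
  rw [h1]
  exact congrArg T.2 (hs.eq_of_eq (by rw [h2]; tauto) h2)

theorem eq_fill {S : D.State} (hS : S.1 = α)
    (hs : IsSaddle (D.circle α) (D.circle T.1) a b)
    (hoff : ∀ p, ¬ (D.circle α p = D.circle α a ∨ D.circle α p = D.circle α b) →
      T.lab p = S.lab p) : S = D.fill α T a b (S.lab a) (S.lab b) := by
  subst hS
  obtain ⟨α, f⟩ := S
  refine Sigma.ext rfl (heq_of_eq (funext fun c => ?_))
  obtain ⟨p, rfl⟩ := D.circle_surjective α c
  change f (D.circle α p) = State.lab (D.fill α T a b _ _) p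
  by_cases hp : D.circle α p = D.circle α a ∨ D.circle α p = D.circle α b
  · unfold fill State.lab
    dsimp only
    split_ifs with h1 h2
    · rw [h1]
    · rw [h2]
    · tauto
  · rw [fill_lab_of_not hs _ _ hp, hoff p hp]
    rfl

end Fill

/-- A labelling passes across an edge of the cube if the labels at the two arcs agree. This is no
condition for a split. -/
theorem respects_update_iff {D : LinkDiagram} {α : D.Smoothing} {ℓ : D.Point → Label}
    {x : Fin D.n} (hx : α x = false) (h : D.Respects α ℓ) :
    D.Respects (Function.update α x true) ℓ ↔ ℓ (.inl (x, 0)) = ℓ (.inl (x, 2)) := by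
  have hs := D.isSaddle hx
  constructor
  · intro h'
    by_cases hab : D.circle α (.inl (x, 0)) = D.circle α (.inl (x, 2))
    · exact h _ _ hab
    · exact h' _ _ (hs.iff.2 hab)
  · intro hab p q hpq
    rcases hs.imp' _ _ hpq with h1 | ⟨h1, h2⟩
    · exact h _ _ h1
    · rcases h1 with h1 | h1 <;> rcases h2 with h2 | h2 <;> simp [h _ _ h1, h _ _ h2, hab]

theorem forall_lab_iff {D : LinkDiagram} {S : D.State} {ℓ : D.Point → Label} {a b : D.Point}
    (hℓ : D.Respects S.1 ℓ) : (∀ p, ℓ p = .x → S.lab p = .x) ↔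
      (ℓ a = .x → S.lab a = .x) ∧ (ℓ b = .x → S.lab b = .x) ∧
      ∀ p, ¬ (D.circle S.1 p = D.circle S.1 a ∨ D.circle S.1 p = D.circle S.1 b) →
        ℓ p = .x → S.lab p = .x := by
  constructor
  · exact fun h => ⟨h a, h b, fun p _ => h p⟩
  · rintro ⟨h1, h2, h3⟩ p
    by_cases hp : D.circle S.1 p = D.circle S.1 a ∨ D.circle S.1 p = D.circle S.1 b
    · rcases hp with hp | hp
      · rw [hℓ _ _ hp]; unfold State.lab at *; rw [hp]; exact h1
      · rw [hℓ _ _ hp]; unfold State.lab at *; rw [hp]; exact h2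
    · exact h3 p hp

/-- The idempotents `x` and `1 + x` are orthogonal, and `Δ` doubles them.  So an edge of the cube
takes a tensor product of idempotents to the one with the same labels, if there is one. -/
theorem edgeMap_idem (D : LinkDiagram) (x : Fin D.n) {α : D.Smoothing} {ℓ : D.Point → Label}
    (hx : α x = false) (hℓ : D.Respects α ℓ) :
    D.edgeMap (bnOps 1) x (D.idem α ℓ) = D.idem (Function.update α x true) ℓ := by
  classical
  ext T
  rw [edgeMap_apply]
  by_cases hT : T.1 = Function.update α x true
  swap
  · have : D.idem (Function.update α x true) ℓ T = 0 := if_neg (by tauto)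
    rw [this]
    refine Finset.sum_eq_zero fun S _ => ?_
    by_contra hne
    have h1 := (edgeCoeff_ne_zero (left_ne_zero_of_mul hne)).2.1
    have h2 := right_ne_zero_of_mul hne
    unfold idem at h2
    rw [ne_eq, ite_eq_right_iff, Classical.not_imp] at h2
    rw [h2.1.1] at h1
    exact hT h1
  set a : D.Point := .inl (x, 0) with ha
  set b : D.Point := .inl (x, 2) with hb
  have hs : IsSaddle (D.circle α) (D.circle T.1) a b := by rw [hT]; exact D.isSaddle hx
  set Off : Prop := ∀ p, ¬ (D.circle α p = D.circle α a ∨ D.circle α p = D.circle α b) →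
    ℓ p = .x → T.lab p = .x with hOff
  have hR : D.idem (Function.update α x true) ℓ T =
      if ℓ a = ℓ b ∧ (ℓ a = .x → T.lab a = .x) ∧ (ℓ b = .x → T.lab b = .x) ∧ Off then 1 else 0 := by
    have h1 : D.Respects T.1 ℓ ↔ ℓ a = ℓ b := by rw [hT]; exact respects_update_iff hx hℓ
    unfold idem
    refine if_congr ?_ rfl rfl
    rw [← hT, h1]
    simp only [true_and]
    refine and_congr_right fun h2 => ?_
    rw [forall_lab_iff (a := a) (b := b) (h1.2 h2)]
    simp only [hOff, hs.mem_iff]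
  -- Only the states on `α` that agree with `T` away from `a` and `b` contribute to the sum.
  have hoff : ∀ S : D.State, S ∉ Set.range (fun w : Label × Label => D.fill α T a b w.1 w.2) →
      D.edgeCoeff (bnOps 1) x S T * D.idem α ℓ S = 0 := by
    intro S hS
    by_contra hne
    obtain ⟨-, -, -, h1, -⟩ := edgeCoeff_ne_zero (left_ne_zero_of_mul hne)
    have h2 := right_ne_zero_of_mul hne
    unfold idem at h2
    rw [ne_eq, ite_eq_right_iff, Classical.not_imp] at h2
    obtain ⟨⟨rfl, -⟩, -⟩ := h2
    exact hS ⟨(S.lab a, S.lab b), (eq_fill rfl hs h1).symm⟩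
  have hidem : ∀ u v, D.idem α ℓ (D.fill α T a b u v) =
      if (ℓ a = .x → (D.fill α T a b u v).lab a = .x) ∧
        (ℓ b = .x → (D.fill α T a b u v).lab b = .x) ∧ Off then 1 else 0 := by
    intro u v
    unfold idem
    refine if_congr ?_ rfl rfl
    rw [forall_lab_iff (S := D.fill α T a b u v) (a := a) (b := b) hℓ]
    have h1 : (D.fill α T a b u v).1 = α := rfl
    simp only [h1, hℓ, true_and]
    refine and_congr_right fun _ => and_congr_right fun _ => ?_
    refine forall_congr' fun p => ⟨fun h hp => ?_, fun h hp => ?_⟩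
    · rw [← fill_lab_of_not hs u v hp]; exact h hp
    · rw [fill_lab_of_not hs u v hp]; exact h hp
  have hcond : ∀ u v, (D.fill α T a b u v).1 x = false ∧
      T.1 = Function.update (D.fill α T a b u v).1 x true ∧
      ∀ p : D.Point, D.circle (D.fill α T a b u v).1 p ≠ D.circle (D.fill α T a b u v).1 a →
        D.circle (D.fill α T a b u v).1 p ≠ D.circle (D.fill α T a b u v).1 b →
        T.lab p = (D.fill α T a b u v).lab p := fun u v =>
    ⟨hx, hT, fun p h1 h2 => (fill_lab_of_not hs u v fun h => h.elim h1 h2).symm⟩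
  rw [hR]
  by_cases hab : D.circle α a = D.circle α b
  -- A split: the sum runs over the label of the circle through `a` and `b`.
  · have hab' : D.circle T.1 a ≠ D.circle T.1 b := fun h => hs.iff.1 h hab
    have hfb : ∀ u v, (D.fill α T a b u v).lab b = u := fun u v => by
      have : (D.fill α T a b u v).lab b = (D.fill α T a b u v).lab a := by
        unfold State.lab
        exact congrArg (D.fill α T a b u v).2 hab.symm
      rw [this, fill_lab_left]
    have hcoeff : ∀ u, D.edgeCoeff (bnOps 1) x (D.fill α T a b u u) T =
        (bnOps 1).comul u (T.lab a) (T.lab b) := fun u => by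
      refine (if_pos (hcond u u)).trans ?_
      refine (if_pos hab).trans ?_
      refine (if_neg hab').trans ?_
      rw [fill_lab_left]
    rw [← Fintype.sum_of_injective (fun u => D.fill α T a b u u) (fun u v huv => by
      have := congrArg (fun S => State.lab S a) huv
      simpa only [fill_lab_left] using this) (fun u => (bnOps 1).comul u (T.lab a) (T.lab b) *
        if (ℓ a = .x → u = .x) ∧ (ℓ b = .x → u = .x) ∧ Off then 1 else 0)]
    · rw [hℓ _ _ hab]
      by_cases ho : Off
      · simp only [ho, and_true, true_and]
        generalize T.lab a = ta
        generalize T.lab b = tb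
        generalize ℓ b = l
        revert ta tb l
        decide
      · simp [ho]
    · intro S hS
      refine hoff S fun ⟨w, hw⟩ => hS ⟨w.1, ?_⟩
      rw [← hw]
      dsimp only
      unfold fill
      congr 1
      ext c
      split_ifs with h1 h2
      · rfl
      · exact absurd (h2.trans hab.symm) h1
      · rfl
    · intro u
      rw [hcoeff, hidem, fill_lab_left, hfb]
  -- A merge: the sum runs over the labels of the two circles.
  · have hab' : D.circle T.1 a = D.circle T.1 b := hs.iff.2 hab
    have hTab : T.lab b = T.lab a := by unfold State.lab; rw [hab']
    have hcoeff : ∀ u v, D.edgeCoeff (bnOps 1) x (D.fill α T a b u v) T =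
        (bnOps 1).mul u v (T.lab a) := fun u v => by
      refine (if_pos (hcond u v)).trans ?_
      refine (if_neg hab).trans ?_
      rw [fill_lab_left, fill_lab_right hab]
    rw [← Fintype.sum_of_injective (fun w : Label × Label => D.fill α T a b w.1 w.2)
      (fun w w' hw => by
        have h1 := congrArg (fun S => State.lab S a) hw
        have h2 := congrArg (fun S => State.lab S b) hw
        simp only [fill_lab_left, fill_lab_right hab] at h1 h2
        exact Prod.ext h1 h2) (fun w => (bnOps 1).mul w.1 w.2 (T.lab a) *
        if (ℓ a = .x → w.1 = .x) ∧ (ℓ b = .x → w.2 = .x) ∧ Off then 1 else 0) _ hoff]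
    · rw [hTab]
      by_cases ho : Off
      · simp only [ho, and_true]
        generalize T.lab a = ta
        generalize ℓ a = la
        generalize ℓ b = lb
        revert ta la lb
        decide
      · simp [ho]
    · intro w
      rw [hcoeff, hidem, fill_lab_left, fill_lab_right hab]

theorem edgeMap_idem_of_true (D : LinkDiagram) (O : Ops) (x : Fin D.n) {α : D.Smoothing}
    (ℓ : D.Point → Label) (hx : α x = true) : D.edgeMap O x (D.idem α ℓ) = 0 := by
  classical
  ext T
  rw [edgeMap_apply]
  refine Finset.sum_eq_zero fun S _ => ?_
  by_contra hne
  have h1 := (edgeCoeff_ne_zero (left_ne_zero_of_mul hne)).1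
  have h2 := right_ne_zero_of_mul hne
  unfold idem at h2
  rw [ne_eq, ite_eq_right_iff, Classical.not_imp] at h2
  rw [h2.1.1, hx] at h1
  cases h1

open Classical in
theorem edgeMap_edgeMap_idem (D : LinkDiagram) (x y : Fin D.n) {α : D.Smoothing}
    {ℓ : D.Point → Label} (hℓ : D.Respects α ℓ) :
    D.edgeMap (bnOps 1) y (D.edgeMap (bnOps 1) x (D.idem α ℓ)) =
      if x ≠ y ∧ α x = false ∧ α y = false then
        D.idem (Function.update (Function.update α x true) y true) ℓ else 0 := by
  by_cases hx : α x = true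
  · rw [edgeMap_idem_of_true D _ x ℓ hx, map_zero, if_neg (by simp [hx])]
  rw [Bool.not_eq_true] at hx
  rw [edgeMap_idem D x hx hℓ]
  by_cases hxy : x = y
  · subst hxy
    rw [edgeMap_idem_of_true D _ x ℓ (by simp), if_neg (by simp)]
  by_cases hy : α y = true
  · rw [edgeMap_idem_of_true D _ y ℓ (by rw [Function.update_of_ne (Ne.symm hxy), hy]),
      if_neg (by simp [hy])]
  rw [Bool.not_eq_true] at hy
  rw [if_pos ⟨hxy, hx, hy⟩]
  by_cases h' : D.Respects (Function.update α x true) ℓ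
  · exact edgeMap_idem D y (by rw [Function.update_of_ne (Ne.symm hxy), hy]) h'
  · rw [idem_eq_zero h', map_zero, idem_eq_zero fun h'' => h' (hℓ.between hxy h'')]

theorem cubeMap_cubeMap_idem (D : LinkDiagram) (α : D.Smoothing) (ℓ : D.Point → Label) :
    D.cubeMap (bnOps 1) (D.cubeMap (bnOps 1) (D.idem α ℓ)) = 0 := by
  classical
  by_cases hℓ : D.Respects α ℓ
  swap
  · rw [idem_eq_zero hℓ, map_zero, map_zero]
  rw [cubeMap_eq_sum]
  simp only [LinearMap.sum_apply, map_sum]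
  rw [← Fintype.sum_prod_type'
    (fun x y => D.edgeMap (bnOps 1) y (D.edgeMap (bnOps 1) x (D.idem α ℓ)))]
  simp only [edgeMap_edgeMap_idem D _ _ hℓ]
  refine Finset.sum_involution (fun w _ => (w.2, w.1)) ?_ ?_ (fun _ _ => Finset.mem_univ _)
    (fun _ _ => rfl)
  · rintro ⟨x, y⟩ -
    dsimp only
    by_cases h : x ≠ y ∧ α x = false ∧ α y = false
    · rw [if_pos h, if_pos ⟨h.1.symm, h.2.2, h.2.1⟩, Function.update_comm h.1]
      ext S
      exact CharTwo.add_self_eq_zero _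
    · rw [if_neg h, if_neg (fun h' => h ⟨h'.1.symm, h'.2.2, h'.2.1⟩), add_zero]
  · rintro ⟨x, y⟩ - h
    rw [ite_ne_right_iff] at h
    intro heq
    exact h.1.1 (congrArg Prod.fst heq).symm

/-- The products of idempotents span: expanding `1 + x` at each circle labelled `1` yields the given
state and states with fewer labels `1`. -/
theorem single_mem_span_idem (D : LinkDiagram) [DecidableEq D.State] (S : D.State) :
    (Pi.single S 1 : D.Chain) ∈
      Submodule.span F2 (Set.range fun w : D.Smoothing × (D.Point → Label) => D.idem w.1 w.2) := by
  induction hm : (Finset.univ.filter fun c => S.2 c = .one).card using Nat.strong_induction_on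
    generalizing S with
  | _ m ih =>
  classical
  have h1 : D.idem S.1 S.lab S = 1 :=
    if_pos ⟨rfl, fun p q h => congrArg S.2 h, fun _ h => h⟩
  have h2 : D.idem S.1 S.lab = Pi.single S 1 +
      ∑ S' ∈ Finset.univ.erase S, D.idem S.1 S.lab S' • Pi.single S' 1 := by
    have h3 := Finset.add_sum_erase Finset.univ
      (fun S' => D.idem S.1 S.lab S' • (Pi.single S' 1 : D.Chain)) (Finset.mem_univ S)
    rw [h1, one_smul] at h3
    rw [h3]
    exact pi_eq_sum_univ' _
  rw [eq_comm, ← eq_sub_iff_add_eq] at h2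
  rw [h2]
  refine Submodule.sub_mem _ (Submodule.subset_span ⟨(S.1, S.lab), rfl⟩)
    (Submodule.sum_mem _ fun S' hS' => ?_)
  by_cases h0 : D.idem S.1 S.lab S' = 0
  · rw [h0, zero_smul]; exact Submodule.zero_mem _
  refine Submodule.smul_mem _ _ (ih _ ?_ S' rfl)
  rw [Finset.mem_erase] at hS'
  unfold idem at h0
  rw [ite_eq_right_iff, Classical.not_imp] at h0
  obtain ⟨⟨h3, -, h4⟩, -⟩ := h0
  rw [← hm]
  obtain ⟨α, f⟩ := S
  obtain ⟨α', f'⟩ := S'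
  obtain rfl : α' = α := h3
  have h5 : ∀ c, f c = .x → f' c = .x := by
    intro c
    obtain ⟨p, rfl⟩ := D.circle_surjective _ c
    exact h4 p
  refine Finset.card_lt_card ((Finset.ssubset_iff_of_subset fun c hc => ?_).2 ?_)
  · rw [Finset.mem_filter] at hc ⊢
    refine ⟨hc.1, ?_⟩
    cases h6 : f c with
    | one => exact h6
    | x => exact absurd ((h5 c h6).symm.trans hc.2) (by simp)
  · by_contra hne
    push Not at hne
    refine hS'.1 (Sigma.ext rfl (heq_of_eq (funext fun c => ?_)))
    cases h6 : f c with
    | x => exact (h5 c h6).trans h6.symm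
    | one => exact (Finset.mem_filter.1 (hne c (by simp [h6]))).2.trans h6.symm

theorem cubeMap_comp_cubeMap (D : LinkDiagram) :
    D.cubeMap (bnOps 1) ∘ₗ D.cubeMap (bnOps 1) = 0 := by
  classical
  have h : Submodule.span F2
      (Set.range fun w : D.Smoothing × (D.Point → Label) => D.idem w.1 w.2) ≤
      LinearMap.ker (D.cubeMap (bnOps 1) ∘ₗ D.cubeMap (bnOps 1)) := by
    rw [Submodule.span_le]
    rintro _ ⟨w, rfl⟩
    exact D.cubeMap_cubeMap_idem w.1 w.2
  refine LinearMap.ext fun v => ?_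
  have hv : v ∈ Submodule.span F2
      (Set.range fun w : D.Smoothing × (D.Point → Label) => D.idem w.1 w.2) := by
    rw [pi_eq_sum_univ' v]
    exact Submodule.sum_mem _ fun S _ => Submodule.smul_mem _ _ (D.single_mem_span_idem S)
  exact h hv

/-! ### The base point action -/

open Classical in
/-- The coefficient of `T` in the product of `x`, acting at `p`, and `S`. -/
noncomputable def xCoeff (D : LinkDiagram) (p : D.Point) (S T : D.State) : F2 :=
  if T.1 = S.1 ∧ ∀ q : D.Point, D.circle S.1 q ≠ D.circle S.1 p → T.lab q = S.lab q then
    khOps.mul .x (S.lab p) (T.lab p) else 0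

theorem xAct_apply (D : LinkDiagram) (p : D.Point) (v : D.Chain) (T : D.State) :
    D.xAct p v T = ∑ S, D.xCoeff p S T * v S := by
  refine Finset.sum_congr rfl fun S _ => congrArg (· * v S) ?_
  unfold xCoeff
  change @ite F2 _ (_) _ _ = @ite F2 _ (_) _ _
  congr

theorem xCoeff_ne_zero {D : LinkDiagram} {p : D.Point} {S T : D.State} (h : D.xCoeff p S T ≠ 0) :
    T.1 = S.1 ∧ (∀ q, D.circle S.1 q ≠ D.circle S.1 p → T.lab q = S.lab q) ∧ T.lab p = .x := by
  have hmul : ∀ s t, khOps.mul .x s t ≠ 0 → t = .x := by decide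
  unfold xCoeff at h
  split_ifs at h with h1
  · exact ⟨h1.1, h1.2, hmul _ _ h⟩
  · exact absurd rfl h

/-- The image of `x` is spanned by the states with the label `x` at the base point. -/
theorem mem_xChain {D : LinkDiagram} {p : D.Point} {v : D.Chain} :
    v ∈ D.xChain p ↔ ∀ S, v S ≠ 0 → S.lab p = .x := by
  classical
  constructor
  · rintro ⟨w, rfl⟩ T hT
    rw [xAct_apply] at hT
    obtain ⟨S, -, hS⟩ := Finset.exists_ne_zero_of_sum_ne_zero hT
    exact (xCoeff_ne_zero (left_ne_zero_of_mul hS)).2.2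
  · intro h
    rw [pi_eq_sum_univ' v]
    refine Submodule.sum_mem _ fun T _ => ?_
    by_cases hT : v T = 0
    · rw [hT, zero_smul]; exact Submodule.zero_mem _
    have hTp := h T hT
    set S : D.State := ⟨T.1, Function.update T.2 (D.circle T.1 p) .one⟩ with hS
    have hSp : S.lab p = .one := by
      change Function.update T.2 (D.circle T.1 p) Label.one (D.circle T.1 p) = _
      rw [Function.update_self]
    have hSq : ∀ q, D.circle T.1 q ≠ D.circle T.1 p → S.lab q = T.lab q := fun q hq => by
      change Function.update T.2 (D.circle T.1 p) Label.one (D.circle T.1 q) = _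
      rw [Function.update_of_ne hq]
      rfl
    refine Submodule.smul_mem _ _ ⟨Pi.single S 1, ?_⟩
    ext T'
    rw [xAct_apply, Finset.sum_eq_single S (fun S' _ hS' => by
      rw [Pi.single_eq_of_ne hS', mul_zero]) (by simp), Pi.single_eq_same, mul_one]
    by_cases hTT : T' = T
    · subst hTT
      rw [Pi.single_eq_same]
      refine (if_pos ⟨rfl, fun q hq => (hSq q hq).symm⟩).trans ?_
      rw [hSp, hTp]
      rfl
    · rw [Pi.single_eq_of_ne hTT]
      by_contra h4
      obtain ⟨h2, h3, h5⟩ := xCoeff_ne_zero h4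
      refine hTT ?_
      clear_value S
      obtain ⟨α, f⟩ := T
      obtain ⟨α', f'⟩ := T'
      obtain ⟨α'', f''⟩ := S
      obtain rfl : α' = α'' := h2
      obtain rfl : α' = α := congrArg Sigma.fst hS
      refine Sigma.ext rfl (heq_of_eq (funext fun c => ?_))
      obtain ⟨q, rfl⟩ := D.circle_surjective _ c
      by_cases hq : D.circle α' q = D.circle α' p
      · rw [hq]; exact h5.trans hTp.symm
      · exact (h3 q hq).trans (hSq q hq)

theorem cubeMap_mem_xChain {D : LinkDiagram} {O : Ops} (hO : O.PreservesX) {p : D.Point}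
    {v : D.Chain} (hv : v ∈ D.xChain p) : D.cubeMap O v ∈ D.xChain p := by
  rw [mem_xChain] at *
  intro T hT
  obtain ⟨x, S, hS, hvS⟩ := exists_of_cubeMap_ne_zero hT
  have hSp := hv S hvS
  obtain ⟨-, -, hs, hoff, hloc⟩ := edgeCoeff_ne_zero hS
  by_cases hp : D.circle S.1 p = D.circle S.1 (.inl (x, 0)) ∨
      D.circle S.1 p = D.circle S.1 (.inl (x, 2))
  swap
  · rw [hoff p hp, hSp]
  have hp' := hs.mem hp
  rcases hloc with ⟨h1, h2, h3⟩ | ⟨h1, h2, h3⟩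
  · have h4 : S.lab (.inl (x, 0)) = .x := by
      rw [← hSp]
      unfold State.lab
      rcases hp with hp | hp
      · rw [hp]
      · rw [hp, h1]
    rw [h4] at h3
    have h5 := hO.comul _ _ h3
    unfold State.lab at *
    rcases hp' with hp' | hp'
    · rw [hp', h5.1]
    · rw [hp', h5.2]
  · have h4 : T.lab p = T.lab (.inl (x, 0)) := by
      unfold State.lab
      rcases hp' with hp' | hp'
      · rw [hp']
      · rw [hp', h2]
    rw [h4]
    have h5 : S.lab (.inl (x, 0)) = .x ∨ S.lab (.inl (x, 2)) = .x := by
      rw [← hSp]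
      unfold State.lab
      rcases hp with hp | hp
      · rw [hp]; exact .inl rfl
      · rw [hp]; exact .inr rfl
    rcases h5 with h5 | h5
    · rw [h5] at h3; exact hO.mul_left _ _ h3
    · rw [h5] at h3; exact hO.mul_right _ _ h3

end LinkDiagram

/-! ### Homogeneous components -/

section Grading

variable {ι V : Type*} [DecidableEq ι] [AddCommGroup V] [Module F2 V] {A : ι → Submodule F2 V}

/-- The component of degree `i`, in a graded vector space. -/
noncomputable def component (h : DirectSum.IsInternal A) (i : ι) : V →ₗ[F2] V :=
  (A i).subtype ∘ₗ DirectSum.component F2 ι (fun i => A i) i ∘ₗ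
    (LinearEquiv.ofBijective (DirectSum.coeLinearMap A) h).symm.toLinearMap

variable (h : DirectSum.IsInternal A)

theorem component_mem (i : ι) (z : V) : component h i z ∈ A i := Subtype.prop _

theorem component_of_mem {i : ι} {z : V} (hz : z ∈ A i) : component h i z = z :=
  congrArg Subtype.val (h.ofBijective_coeLinearMap_of_mem hz)

theorem component_of_mem_ne {i j : ι} (hij : i ≠ j) {z : V} (hz : z ∈ A i) :
    component h j z = 0 :=
  congrArg Subtype.val (h.ofBijective_coeLinearMap_of_mem_ne hij hz)

theorem mem_of_component_mem {S : Submodule F2 V} {z : V} (hz : ∀ i, component h i z ∈ S) :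
    z ∈ S := by
  classical
  have h1 : DirectSum.coeLinearMap A
      ((LinearEquiv.ofBijective (DirectSum.coeLinearMap A) h).symm z) = z :=
    (LinearEquiv.ofBijective (DirectSum.coeLinearMap A) h).apply_symm_apply z
  rw [← h1, DirectSum.coeLinearMap_eq_dfinsuppSum]
  exact Submodule.sum_mem _ fun i _ => hz i

theorem mem_iSup_iff_component {P : ι → Prop} {z : V} :
    z ∈ ⨆ (i) (_ : P i), A i ↔ ∀ i, ¬ P i → component h i z = 0 := by
  constructor
  · intro hz i hi
    have : ⨆ (i) (_ : P i), A i ≤ LinearMap.ker (component h i) :=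
      iSup₂_le fun j hj w hw => component_of_mem_ne h (fun hji : j = i => hi (hji ▸ hj)) hw
    exact this hz
  · intro hz
    refine mem_of_component_mem h fun i => ?_
    by_cases hi : P i
    · exact Submodule.mem_iSup_of_mem i (Submodule.mem_iSup_of_mem hi (component_mem h i z))
    · rw [hz i hi]
      exact Submodule.zero_mem _

include h in
theorem linearMap_ext_of_isInternal {W : Type*} [AddCommGroup W] [Module F2 W] {f g : V →ₗ[F2] W}
    (hfg : ∀ i, ∀ z ∈ A i, f z = g z) : f = g := by
  refine LinearMap.ext fun z => ?_
  have : z ∈ LinearMap.eqLocus f g :=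
    mem_of_component_mem h fun i => hfg i _ (component_mem h i z)
  exact this

theorem component_map {f : V →ₗ[F2] V} {s : ι → ι} (hs : Function.Injective s)
    (hf : ∀ i, ∀ z ∈ A i, f z ∈ A (s i)) (i : ι) (z : V) :
    component h (s i) (f z) = f (component h i z) := by
  refine LinearMap.congr_fun (f := component h (s i) ∘ₗ f) (g := f ∘ₗ component h i)
    (linearMap_ext_of_isInternal h fun j w hw => ?_) z
  rw [LinearMap.comp_apply, LinearMap.comp_apply]
  by_cases hij : j = i
  · subst hij
    rw [component_of_mem h hw, component_of_mem h (hf _ _ hw)]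
  · rw [component_of_mem_ne h hij hw, map_zero,
      component_of_mem_ne h (fun h' => hij (hs h')) (hf _ _ hw)]

end Grading

/-! ### Subquotients -/

section Subquot

variable {V : Type} [AddCommGroup V] [Module F2 V] {Z B Z' B' : Submodule F2 V}

theorem exists_eq_cls (ξ : Subquot Z B) : ∃ z, ∃ hz : z ∈ Z, cls Z B z hz = ξ := by
  obtain ⟨⟨z, hz⟩, rfl⟩ := Submodule.Quotient.mk_surjective _ ξ
  exact ⟨z, hz, rfl⟩

theorem cls_eq_zero_iff {z : V} {hz : z ∈ Z} : cls Z B z hz = 0 ↔ z ∈ B :=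
  (Submodule.Quotient.mk_eq_zero _).trans Iff.rfl

theorem cls_eq_cls_iff {z w : V} {hz : z ∈ Z} {hw : w ∈ Z} :
    cls Z B z hz = cls Z B w hw ↔ z - w ∈ B :=
  (Submodule.Quotient.eq _).trans Iff.rfl

theorem inducedMap_cls {f : V →ₗ[F2] V} (h₁ : ∀ z ∈ Z, f z ∈ Z') (h₂ : ∀ z ∈ Z, z ∈ B → f z ∈ B')
    {z : V} (hz : z ∈ Z) :
    inducedMap f Z B Z' B' (cls Z B z hz) = cls Z' B' (f z) (h₁ z hz) := by
  unfold inducedMap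
  rw [dif_pos ⟨h₁, h₂⟩]
  rfl

/-- Two surjections with the same kernel identify their targets. -/
theorem exists_equiv_of_ker_eq {G A B : Type*} [AddCommGroup G] [Module F2 G] [AddCommGroup A]
    [Module F2 A] [AddCommGroup B] [Module F2 B] {f : G →ₗ[F2] A} {g : G →ₗ[F2] B}
    (hf : Function.Surjective f) (hg : Function.Surjective g)
    (h : ∀ z, f z = 0 ↔ g z = 0) : ∃ e : A ≃ₗ[F2] B, ∀ z, e (f z) = g z := by
  have hk : LinearMap.ker f = LinearMap.ker g := by
    ext z; exact h z
  refine ⟨(f.quotKerEquivOfSurjective hf).symm ≪≫ₗ Submodule.quotEquivOfEq _ _ hk ≪≫ₗ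
    g.quotKerEquivOfSurjective hg, fun z => ?_⟩
  have : (f.quotKerEquivOfSurjective hf).symm (f z) = Submodule.Quotient.mk z := by
    rw [LinearEquiv.symm_apply_eq]; rfl
  rw [LinearEquiv.trans_apply, LinearEquiv.trans_apply, this]
  rfl

end Subquot

namespace Theory

/-! ### Filtered complexes from a differential with two homogeneous summands -/

/-- A finite-dimensional bigraded complex whose differential is the sum of maps of bidegrees
`(1, 0)` and `(1, 2)`, with `q`-degrees of the parity of `c`. -/
structure IsBigradedComplex (K : Theory) (c : ℤ) : Prop where
  finite : Module.Finite F2 K.V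
  bigraded : DirectSum.IsInternal fun ij : ℤ × ℤ => K.bideg ij.1 ij.2
  parity : ∀ i j, (¬ ∃ k, j = 2 * k + c) → K.bideg i j = ⊥
  d_eq : K.d = K.del + K.beta
  del_mem : ∀ i j, ∀ z ∈ K.bideg i j, K.del z ∈ K.bideg (i + 1) j
  beta_mem : ∀ i j, ∀ z ∈ K.bideg i j, K.beta z ∈ K.bideg (i + 1) (j + 2)
  d_d : K.d ∘ₗ K.d = 0

namespace IsBigradedComplex

variable {K : Theory} {c : ℤ} (H : K.IsBigradedComplex c)

include H in
theorem d_apply (z : K.V) : K.d z = K.del z + K.beta z := by rw [H.d_eq]; rfl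

include H in
theorem d_d_apply (z : K.V) : K.d (K.d z) = 0 := LinearMap.congr_fun H.d_d z

/-- The component of bidegree `(i, j)`. -/
noncomputable def proj (i j : ℤ) : K.V →ₗ[F2] K.V := component H.bigraded (i, j)

theorem proj_mem (i j : ℤ) (z : K.V) : H.proj i j z ∈ K.bideg i j :=
  component_mem H.bigraded (i, j) z

theorem proj_of_mem {i j : ℤ} {z : K.V} (hz : z ∈ K.bideg i j) : H.proj i j z = z :=
  component_of_mem H.bigraded (i := (i, j)) hz

theorem proj_of_mem_ne {i j i' j' : ℤ} (h : i ≠ i' ∨ j ≠ j') {z : K.V} (hz : z ∈ K.bideg i j) :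
    H.proj i' j' z = 0 :=
  component_of_mem_ne H.bigraded (i := (i, j)) (fun h' => by simp at h'; tauto) hz

theorem proj_del (i j : ℤ) (z : K.V) : H.proj (i + 1) j (K.del z) = K.del (H.proj i j z) :=
  component_map H.bigraded (s := fun ij => (ij.1 + 1, ij.2))
    (fun a b h => by simp at h; exact Prod.ext h.1 h.2) (fun ij => H.del_mem ij.1 ij.2) (i, j) z

theorem proj_eq_zero_of_parity {i j : ℤ} (h : ¬ ∃ k, j = 2 * k + c) (z : K.V) :
    H.proj i j z = 0 := by
  have := H.proj_mem i j z
  rwa [H.parity i j h, Submodule.mem_bot] at this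

theorem mem_fil_iff {k : ℤ} {z : K.V} :
    z ∈ K.fil c k ↔ ∀ i j, j < 2 * k + c → H.proj i j z = 0 := by
  have : K.fil c k = ⨆ (ij : ℤ × ℤ) (_ : 2 * k + c ≤ ij.2), K.bideg ij.1 ij.2 := by
    rw [iSup_prod]; rfl
  rw [this]
  refine (mem_iSup_iff_component H.bigraded (P := fun ij : ℤ × ℤ => 2 * k + c ≤ ij.2)).trans ?_
  exact ⟨fun h i j hj => h (i, j) (not_le.2 hj), fun h ij hj => h ij.1 ij.2 (not_le.1 hj)⟩

theorem mem_cochains_iff {n : ℤ} {z : K.V} :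
    z ∈ K.cochains n ↔ ∀ i j, i ≠ n → H.proj i j z = 0 := by
  have : K.cochains n = ⨆ (ij : ℤ × ℤ) (_ : ij.1 = n), K.bideg ij.1 ij.2 := by
    refine le_antisymm (iSup_le fun j => le_iSup₂_of_le (n, j) rfl le_rfl) (iSup₂_le ?_)
    rintro ⟨i, j⟩ rfl
    exact le_iSup (fun j => K.bideg i j) j
  rw [this]
  refine (mem_iSup_iff_component H.bigraded (P := fun ij : ℤ × ℤ => ij.1 = n)).trans ?_
  exact ⟨fun h i j hj => h (i, j) hj, fun h ij hj => h ij.1 ij.2 hj⟩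

include H in
theorem fil_anti : Antitone (K.fil c) := by
  intro k k' hk z hz
  rw [H.mem_fil_iff] at *
  exact fun i j hj => hz i j (by omega)

include H in
theorem bideg_le_fil {i j k : ℤ} (h : 2 * k + c ≤ j) : K.bideg i j ≤ K.fil c k := by
  intro z hz
  rw [H.mem_fil_iff]
  exact fun i' j' hj' => H.proj_of_mem_ne (.inr (by omega)) hz

theorem bideg_le_cochains (K : Theory) (i j : ℤ) : K.bideg i j ≤ K.cochains i :=
  le_iSup (fun j => K.bideg i j) j

include H in
theorem beta_mem_bideg {i j i' j' : ℤ} (hi : i' = i + 1) (hj : j' = j + 2) {z : K.V}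
    (hz : z ∈ K.bideg i j) : K.beta z ∈ K.bideg i' j' := by
  subst hi hj
  exact H.beta_mem i j z hz

include H in
theorem del_mem_bideg {i j i' : ℤ} (hi : i' = i + 1) {z : K.V}
    (hz : z ∈ K.bideg i j) : K.del z ∈ K.bideg i' j := by
  subst hi
  exact H.del_mem i j z hz

include H in
theorem d_mem_fil {k : ℤ} {z : K.V} (hz : z ∈ K.fil c k) : K.d z ∈ K.fil c k := by
  have : K.fil c k ≤ (K.fil c k).comap K.d := by
    refine iSup_le fun i => iSup₂_le fun j hj w hw => ?_
    rw [Submodule.mem_comap, H.d_apply]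
    exact Submodule.add_mem _ (H.bideg_le_fil hj (H.del_mem i j w hw))
      (H.bideg_le_fil (by omega) (H.beta_mem i j w hw))
  exact this hz

include H in
theorem d_mem_cochains {n n' : ℤ} (hn : n' = n + 1) {z : K.V} (hz : z ∈ K.cochains n) :
    K.d z ∈ K.cochains n' := by
  subst hn
  have : K.cochains n ≤ (K.cochains (n + 1)).comap K.d := by
    refine iSup_le fun j w hw => ?_
    rw [Submodule.mem_comap, H.d_apply]
    exact Submodule.add_mem _ (bideg_le_cochains K _ _ (H.del_mem n j w hw))
      (bideg_le_cochains K _ _ (H.beta_mem n j w hw))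
  exact this hz

include H in
theorem beta_mem_fil {k : ℤ} {z : K.V} (hz : z ∈ K.fil c k) : K.beta z ∈ K.fil c (k + 1) := by
  have : K.fil c k ≤ (K.fil c (k + 1)).comap K.beta := by
    refine iSup_le fun i => iSup₂_le fun j hj w hw => ?_
    exact H.bideg_le_fil (by omega) (H.beta_mem i j w hw)
  exact this hz

include H in
theorem exists_bound : ∃ N : ℤ, ∀ i j, K.bideg i j ≠ ⊥ → -N ≤ j ∧ j ≤ N := by
  have := H.finite
  have hfin : {ij : ℤ × ℤ | K.bideg ij.1 ij.2 ≠ ⊥}.Finite :=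
    Submodule.finite_ne_bot_of_iSupIndep H.bigraded.submodule_iSupIndep
  obtain ⟨N, hN⟩ := (hfin.image fun ij => |ij.2|).bddAbove
  refine ⟨N, fun i j hij => abs_le.1 (hN ⟨(i, j), hij, rfl⟩)⟩

theorem proj_eq_zero_of_bideg {i j : ℤ} (h : K.bideg i j = ⊥) (z : K.V) : H.proj i j z = 0 := by
  have := H.proj_mem i j z
  rwa [h, Submodule.mem_bot] at this

theorem eq_zero_of_proj {z : K.V} (h : ∀ i j, H.proj i j z = 0) : z = 0 :=
  (Submodule.mem_bot F2).1 (mem_of_component_mem H.bigraded fun ij =>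
    (Submodule.mem_bot F2).2 (h ij.1 ij.2))

include H in
theorem fil_bot : ∃ k, K.fil c k = ⊥ := by
  obtain ⟨N, hN⟩ := H.exists_bound
  refine ⟨|N| + |c| + 1, (Submodule.eq_bot_iff _).2 fun z hz => H.eq_zero_of_proj fun i j => ?_⟩
  have := neg_abs_le c
  have := le_abs_self N
  have := abs_nonneg N
  have := abs_nonneg c
  by_cases hj : j ≤ N
  · exact H.mem_fil_iff.1 hz i j (by omega)
  · exact H.proj_eq_zero_of_bideg (by by_contra h; have := hN i j h; omega) z

include H in
theorem fil_top : ∃ k, K.fil c k = ⊤ := by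
  obtain ⟨N, hN⟩ := H.exists_bound
  refine ⟨-(|N| + |c| + 1), (Submodule.eq_top_iff'.2) fun z => H.mem_fil_iff.2 fun i j hj => ?_⟩
  have := le_abs_self c
  have := le_abs_self N
  have := abs_nonneg N
  have := abs_nonneg c
  exact H.proj_eq_zero_of_bideg (by by_contra h; have := hN i j h; omega) z

include H in
/-- The bihomogeneous parts of `d ∘ d = 0`. -/
theorem del_del_of_mem {i j : ℤ} {z : K.V} (hz : z ∈ K.bideg i j) :
    K.del (K.del z) = 0 ∧ K.del (K.beta z) + K.beta (K.del z) = 0 ∧ K.beta (K.beta z) = 0 := by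
  have h := H.d_d_apply z
  rw [H.d_apply, H.d_apply, map_add, map_add] at h
  have h1 : K.del (K.del z) ∈ K.bideg (i + 1 + 1) j := H.del_mem _ _ _ (H.del_mem _ _ _ hz)
  have h2 : K.del (K.beta z) + K.beta (K.del z) ∈ K.bideg (i + 1 + 1) (j + 2) :=
    Submodule.add_mem _ (H.del_mem _ _ _ (H.beta_mem _ _ _ hz))
      (H.beta_mem _ _ _ (H.del_mem _ _ _ hz))
  have h3 : K.beta (K.beta z) ∈ K.bideg (i + 1 + 1) (j + 2 + 2) :=
    H.beta_mem _ _ _ (H.beta_mem _ _ _ hz)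
  have h' : K.del (K.del z) + (K.del (K.beta z) + K.beta (K.del z)) + K.beta (K.beta z) = 0 := by
    rw [← h]; abel
  have p : ∀ j', H.proj (i + 1 + 1) j' (K.del (K.del z)) +
      H.proj (i + 1 + 1) j' (K.del (K.beta z) + K.beta (K.del z)) +
      H.proj (i + 1 + 1) j' (K.beta (K.beta z)) = 0 := fun j' => by
    rw [← map_add, ← map_add, h', map_zero]
  refine ⟨?_, ?_, ?_⟩
  · have := p j
    rwa [H.proj_of_mem h1, H.proj_of_mem_ne (.inr (by omega)) h2,
      H.proj_of_mem_ne (.inr (by omega)) h3, add_zero, add_zero] at this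
  · have := p (j + 2)
    rwa [H.proj_of_mem_ne (.inr (by omega)) h1, H.proj_of_mem h2,
      H.proj_of_mem_ne (.inr (by omega)) h3, add_zero, zero_add] at this
  · have := p (j + 2 + 2)
    rwa [H.proj_of_mem_ne (.inr (by omega)) h1, H.proj_of_mem_ne (.inr (by omega)) h2,
      H.proj_of_mem h3, zero_add, zero_add] at this

include H in
theorem del_beta_of_mem {i j : ℤ} {z : K.V} (hz : z ∈ K.bideg i j) :
    K.del (K.beta z) = - K.beta (K.del z) :=
  eq_neg_of_add_eq_zero_left (H.del_del_of_mem hz).2.1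

include H in
theorem beta_mem_khZ {i j i' j' : ℤ} (hi : i' = i + 1) (hj : j' = j + 2) {z : K.V}
    (hz : z ∈ K.khZ i j) : K.beta z ∈ K.khZ i' j' := by
  refine ⟨H.beta_mem_bideg hi hj hz.1, ?_⟩
  change K.del (K.beta z) = 0
  rw [H.del_beta_of_mem hz.1, LinearMap.mem_ker.1 hz.2, map_zero, neg_zero]

include H in
theorem beta_mem_khB {i j i' j' : ℤ} (hi : i' = i + 1) (hj : j' = j + 2) {z : K.V}
    (hz : z ∈ K.khB i j) : K.beta z ∈ K.khB i' j' := by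
  obtain ⟨w, hw, rfl⟩ := hz
  refine ⟨- K.beta w, Submodule.neg_mem _ (H.beta_mem_bideg (by omega) hj hw), ?_⟩
  rw [map_neg, H.del_beta_of_mem hw, neg_neg]

include H in
theorem betaStar_cls {i j i' j' : ℤ} (hi : i' = i + 1) (hj : j' = j + 2) {z : K.V}
    (hz : z ∈ K.khZ i j) : K.betaStar i j i' j' (cls _ _ z hz) =
      cls _ _ (K.beta z) (H.beta_mem_khZ hi hj hz) :=
  inducedMap_cls (fun _ h => H.beta_mem_khZ hi hj h) (fun _ _ h => H.beta_mem_khB hi hj h) hz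

include H in
theorem isFilteredComplex : K.IsFilteredComplex c where
  finite := H.finite
  bigraded := H.bigraded
  parity := H.parity
  d_eq := H.d_eq
  del_mem := H.del_mem
  beta_mem := H.beta_mem
  del_del := linearMap_ext_of_isInternal H.bigraded fun _ _ hz => (H.del_del_of_mem hz).1
  d_d := H.d_d
  d_mem _ _ hz := H.d_mem_cochains rfl hz
  d_fil _ _ hz := H.d_mem_fil hz
  fil_anti := H.fil_anti
  fil_bot := H.fil_bot
  fil_top := H.fil_top
  betaStar_cls _ _ _ hz := ⟨H.beta_mem_khZ rfl rfl hz, H.betaStar_cls rfl rfl hz⟩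
  betaStar_betaStar i j := by
    refine LinearMap.ext fun ξ => ?_
    obtain ⟨z, hz, rfl⟩ := exists_eq_cls ξ
    rw [LinearMap.comp_apply, H.betaStar_cls rfl rfl hz, H.betaStar_cls rfl rfl,
      LinearMap.zero_apply, cls_eq_zero_iff, (H.del_del_of_mem hz.1).2.2]
    exact Submodule.zero_mem _

/-- Removing its component of lowest `q`-degree moves a cochain up in the filtration. -/
theorem sub_proj_mem {k n : ℤ} {z : K.V} (hz : z ∈ K.fil c k) (hn : z ∈ K.cochains n) :
    z - H.proj n (2 * k + c) z ∈ K.fil c (k + 1) := by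
  rw [H.mem_fil_iff] at hz ⊢
  rw [H.mem_cochains_iff] at hn
  intro i j hj
  rw [map_sub]
  by_cases h : n = i ∧ 2 * k + c = j
  · obtain ⟨rfl, rfl⟩ := h
    rw [H.proj_of_mem (H.proj_mem _ _ _), sub_self]
  rw [H.proj_of_mem_ne (not_and_or.1 h) (H.proj_mem n (2 * k + c) z), sub_zero]
  by_cases hi : i = n
  · by_cases hj' : j < 2 * k + c
    · exact hz i j hj'
    · exact H.proj_eq_zero_of_parity (by rintro ⟨m, hm⟩; omega) z
  · exact hn i j hi

theorem proj_eq_zero_of_mem_fil {k n : ℤ} {z : K.V} (hz : z ∈ K.fil c (k + 1)) :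
    H.proj n (2 * k + c) z = 0 :=
  H.mem_fil_iff.1 hz _ _ (by omega)

/-- To lowest order, `d` is `∂`. -/
theorem proj_d {k n n' : ℤ} (hn : n' = n + 1) {z : K.V} (hz : z ∈ K.fil c k) :
    H.proj n' (2 * k + c) (K.d z) = K.del (H.proj n (2 * k + c) z) := by
  subst hn
  rw [H.d_apply, map_add, H.proj_del, H.proj_eq_zero_of_mem_fil (H.beta_mem_fil hz), add_zero]

/-! ### The spectral sequence -/

theorem mem_ssZ {r k n : ℤ} {z : K.V} :
    z ∈ K.ssZ c r k n ↔ z ∈ K.fil c k ∧ z ∈ K.cochains n ∧ K.d z ∈ K.fil c (k + r) :=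
  and_assoc

theorem mem_ssB {r k n : ℤ} {z : K.V} : z ∈ K.ssB c r k n ↔
    ∃ w ∈ K.ssZ c (r - 1) (k + 1) n, ∃ v ∈ K.ssZ c (r - 1) (k - r + 1) (n - 1),
      w + K.d v = z := by
  unfold ssB
  simp only [Submodule.mem_sup, Submodule.mem_map, exists_exists_and_eq_and]

include H in
theorem fil_le {k k' : ℤ} (h : k' ≤ k) {z : K.V} (hz : z ∈ K.fil c k) : z ∈ K.fil c k' :=
  H.fil_anti h hz

include H in
theorem ssZ_mono {r k r' k' n : ℤ} (hk : k' ≤ k) (hr : k' + r' ≤ k + r) {z : K.V}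
    (hz : z ∈ K.ssZ c r k n) : z ∈ K.ssZ c r' k' n := by
  rw [mem_ssZ] at hz ⊢
  exact ⟨H.fil_le hk hz.1, hz.2.1, H.fil_le hr hz.2.2⟩

include H in
theorem d_mem_ssZ {r k n k' n' s : ℤ} (hk : k' = k + r) (hn : n' = n + 1) {z : K.V}
    (hz : z ∈ K.ssZ c r k n) : K.d z ∈ K.ssZ c s k' n' := by
  rw [mem_ssZ] at hz ⊢
  refine ⟨by rw [hk]; exact hz.2.2, H.d_mem_cochains hn hz.2.1, ?_⟩
  rw [H.d_d_apply]
  exact Submodule.zero_mem _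

include H in
theorem d_mem_ssB {r k n k' n' : ℤ} (hk : k' = k + r) (hn : n' = n + 1) {z : K.V}
    (hz : z ∈ K.ssB c r k n) : K.d z ∈ K.ssB c r k' n' := by
  obtain ⟨w, hw, v, hv, rfl⟩ := mem_ssB.1 hz
  rw [map_add, H.d_d_apply, add_zero]
  refine mem_ssB.2 ⟨0, Submodule.zero_mem _, w, ?_, zero_add _⟩
  rw [show k' - r + 1 = k + 1 by omega, show n' - 1 = n by omega]
  exact hw

/-- Cochains killed by `d_r` are represented by elements of the next `Z_{r+1}`. -/
theorem exists_mem_ssZ_succ {r k n : ℤ} (H : K.IsBigradedComplex c) {z : K.V}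
    (hz : z ∈ K.ssZ c r k n) (hdz : K.d z ∈ K.ssB c r (k + r) (n + 1)) :
    ∃ z' ∈ K.ssZ c (r + 1) k n, z' - z ∈ K.ssB c r k n := by
  obtain ⟨u, hu, w, hw, huw⟩ := mem_ssB.1 hdz
  rw [show k + r - r + 1 = k + 1 by omega, show n + 1 - 1 = n by omega] at hw
  refine ⟨z - w, mem_ssZ.2 ⟨?_, ?_, ?_⟩, ?_⟩
  · exact Submodule.sub_mem _ (mem_ssZ.1 hz).1 (H.fil_le (by omega) (mem_ssZ.1 hw).1)
  · exact Submodule.sub_mem _ (mem_ssZ.1 hz).2.1 (mem_ssZ.1 hw).2.1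
  · rw [map_sub, ← huw, add_sub_cancel_right]
    exact H.fil_le (by omega) (mem_ssZ.1 hu).1
  · rw [sub_sub_cancel_left]
    exact Submodule.neg_mem _ (Submodule.mem_sup_left hw)

/-- The denominator of `E_{r+1}` consists of the representatives of boundaries of `d_r`. -/
theorem mem_ssB_succ_iff {r k n : ℤ} (H : K.IsBigradedComplex c) {z : K.V}
    (hz : z ∈ K.ssZ c (r + 1) k n) : z ∈ K.ssB c (r + 1) k n ↔
      ∃ v ∈ K.ssZ c r (k - r) (n - 1), z - K.d v ∈ K.ssB c r k n := by
  constructor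
  · intro h
    obtain ⟨w, hw, v, hv, rfl⟩ := mem_ssB.1 h
    rw [show r + 1 - 1 = r by omega] at hw hv
    rw [show k - (r + 1) + 1 = k - r by omega] at hv
    refine ⟨v, hv, ?_⟩
    rw [add_sub_cancel_right]
    exact Submodule.mem_sup_left (H.ssZ_mono le_rfl (by omega) hw)
  · rintro ⟨v, hv, h⟩
    obtain ⟨w, hw, v', hv', hwv⟩ := mem_ssB.1 h
    have hz' : z = w + K.d (v + v') := by
      rw [map_add, add_left_comm, hwv, add_sub_cancel]
    refine mem_ssB.2 ⟨w, ?_, v + v', ?_, hz'.symm⟩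
    · refine mem_ssZ.2 ⟨(mem_ssZ.1 hw).1, (mem_ssZ.1 hw).2.1, ?_⟩
      have : K.d z = K.d w := by rw [hz', map_add, H.d_d_apply, add_zero]
      rw [← this]
      exact H.fil_le (by omega) (mem_ssZ.1 hz).2.2
    · rw [show r + 1 - 1 = r by omega, show k - (r + 1) + 1 = k - r by omega]
      exact Submodule.add_mem _ hv (H.ssZ_mono (by omega) (by omega) hv')

/-- The term `E_r^{k,l}`, for `n = k + l`. The total degree `n` is an independent variable, so that
equal degrees never have to be identified across a dependent type. -/
abbrev Page (K : Theory) (c r k n : ℤ) : Type := Subquot (K.ssZ c r k n) (K.ssB c r k n)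

/-- The differential of the page `E_r`, to be used for `k' = k + r` and `n' = n + 1`. -/
noncomputable def pageD (K : Theory) (c r k n k' n' : ℤ) :
    Page K c r k n →ₗ[F2] Page K c r k' n' :=
  inducedMap K.d (K.ssZ c r k n) (K.ssB c r k n) (K.ssZ c r k' n') (K.ssB c r k' n')

include H in
theorem pageD_cls {r k n k' n' : ℤ} (hk : k' = k + r) (hn : n' = n + 1) {z : K.V}
    (hz : z ∈ K.ssZ c r k n) : pageD K c r k n k' n' (cls _ _ z hz) =
      cls _ _ (K.d z) (H.d_mem_ssZ hk hn hz) :=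
  inducedMap_cls (fun _ h => H.d_mem_ssZ hk hn h) (fun _ _ h => H.d_mem_ssB hk hn h) hz

theorem rel_iff {r k l k' l' : ℤ} :
    (ComplexShape.up' ((r, 1 - r) : ℤ × ℤ)).Rel (k, l) (k', l') ↔ k' = k + r ∧ l' = l + 1 - r := by
  change (k, l) + (r, 1 - r) = (k', l') ↔ _
  rw [Prod.mk_add_mk, Prod.mk.injEq]
  omega

open Classical in
/-- The page `E_r`, a complex with differential of bidegree `(r, 1 - r)`. -/
noncomputable def page (H : K.IsBigradedComplex c) (r : ℤ) :
    HomologicalComplex (ModuleCat.{0} F2) (ComplexShape.up' ((r, 1 - r) : ℤ × ℤ)) where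
  X p := ModuleCat.of F2 (Page K c r p.1 (p.1 + p.2))
  d p q := if (ComplexShape.up' ((r, 1 - r) : ℤ × ℤ)).Rel p q then
    ModuleCat.ofHom (pageD K c r p.1 (p.1 + p.2) q.1 (q.1 + q.2)) else 0
  shape p q h := if_neg h
  d_comp_d' := by
    rintro ⟨k, l⟩ ⟨k', l'⟩ ⟨k'', l''⟩ h h'
    rw [if_pos h, if_pos h']
    obtain ⟨rfl, rfl⟩ := rel_iff.1 h
    obtain ⟨rfl, rfl⟩ := rel_iff.1 h'
    refine ModuleCat.hom_ext (LinearMap.ext fun ξ => ?_)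
    obtain ⟨z, hz, rfl⟩ := exists_eq_cls ξ
    change pageD K c r _ _ _ _ (pageD K c r _ _ _ _ (cls _ _ z hz)) = 0
    rw [H.pageD_cls (by dsimp only) (by dsimp only; omega), H.pageD_cls (by dsimp only)
      (by dsimp only; omega), cls_eq_zero_iff, H.d_d_apply]
    exact Submodule.zero_mem _

theorem page_d {r k l k' l' : ℤ} (h : k' = k + r) (h' : l' = l + 1 - r)
    (ξ : Page K c r k (k + l)) : ((H.page r).d (k, l) (k', l')).hom ξ =
      pageD K c r k (k + l) k' (k' + l') ξ := by
  have : (H.page r).d (k, l) (k', l') =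
      ModuleCat.ofHom (pageD K c r k (k + l) k' (k' + l')) := if_pos (rel_iff.2 ⟨h, h'⟩)
  rw [this]
  rfl

theorem page_d_cls {r k l k' l' : ℤ} (h : k' = k + r) (h' : l' = l + 1 - r) {z : K.V}
    (hz : z ∈ K.ssZ c r k (k + l)) :
    ((H.page r).d (k, l) (k', l')).hom (cls (K.ssZ c r k (k + l)) (K.ssB c r k (k + l)) z hz) =
      cls (K.ssZ c r k' (k' + l')) (K.ssB c r k' (k' + l')) (K.d z)
        (H.d_mem_ssZ h (by omega) hz) := by
  rw [H.page_d h h']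
  exact H.pageD_cls h (by omega) hz

theorem sc_g_eq_zero_iff {ι : Type*} {s : ComplexShape ι}
    (C : HomologicalComplex (ModuleCat.{0} F2) s)
    {i j : ι} (h : s.next i = j) (ξ : C.X i) :
    (C.sc i).g.hom ξ = 0 ↔ (C.d i j).hom ξ = 0 := by
  subst h; rfl

theorem mem_range_sc_f_iff {ι : Type*} {s : ComplexShape ι}
    (C : HomologicalComplex (ModuleCat.{0} F2) s) {i j : ι} (h : s.prev j = i) (ξ : C.X j) :
    (∃ η, (C.sc j).f.hom η = ξ) ↔ ∃ η, (C.d i j).hom η = ξ := by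
  subst h; rfl

include H in
/-- The kernel of `d_r` is the image of `Z_{r+1}`. -/
theorem pageD_eq_zero_iff {r k n k' n' : ℤ} (hk : k' = k + r) (hn : n' = n + 1)
    (ξ : Page K c r k n) : pageD K c r k n k' n' ξ = 0 ↔
      ∃ z, ∃ h : z ∈ K.ssZ c r k n, z ∈ K.ssZ c (r + 1) k n ∧ cls _ _ z h = ξ := by
  subst hk hn
  constructor
  · intro h
    obtain ⟨z, hz, rfl⟩ := exists_eq_cls ξ
    rw [H.pageD_cls rfl rfl, cls_eq_zero_iff] at h
    obtain ⟨z', hz', hzz⟩ := H.exists_mem_ssZ_succ hz h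
    exact ⟨z', H.ssZ_mono le_rfl (by omega) hz', hz', cls_eq_cls_iff.2 hzz⟩
  · rintro ⟨z, hz, hz', rfl⟩
    rw [H.pageD_cls rfl rfl, cls_eq_zero_iff]
    refine Submodule.mem_sup_left (mem_ssZ.2 ⟨?_, ?_, ?_⟩)
    · rw [show k + r + 1 = k + (r + 1) by omega]; exact (mem_ssZ.1 hz').2.2
    · exact H.d_mem_cochains rfl (mem_ssZ.1 hz).2.1
    · rw [H.d_d_apply]; exact Submodule.zero_mem _

include H in
theorem cls_mem_range_pageD_iff {r k n k' n' : ℤ} (hk : k' = k - r) (hn : n' = n - 1) {z : K.V}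
    (h : z ∈ K.ssZ c r k n) (h' : z ∈ K.ssZ c (r + 1) k n) :
    (∃ η, pageD K c r k' n' k n η = cls _ _ z h) ↔ z ∈ K.ssB c (r + 1) k n := by
  subst hk hn
  rw [H.mem_ssB_succ_iff h']
  constructor
  · rintro ⟨η, hη⟩
    obtain ⟨v, hv, rfl⟩ := exists_eq_cls η
    rw [H.pageD_cls (by omega) (by omega), eq_comm, cls_eq_cls_iff] at hη
    exact ⟨v, hv, hη⟩
  · rintro ⟨v, hv, h2⟩
    refine ⟨cls _ _ v hv, ?_⟩
    rw [H.pageD_cls (by omega) (by omega), eq_comm, cls_eq_cls_iff]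
    exact h2

/-- The homology of a page is the next page, by the identity on representatives. -/
theorem exists_homology_equiv (r k l : ℤ) :
    ∃ e : (LinearMap.ker ((H.page r).sc (k, l)).g.hom ⧸
        LinearMap.range ((H.page r).sc (k, l)).moduleCatToCycles) ≃ₗ[F2]
        Page K c (r + 1) k (k + l),
      ∀ (z : K.V) (h : z ∈ K.ssZ c r k (k + l)) (h' : z ∈ K.ssZ c (r + 1) k (k + l))
        (y : LinearMap.ker ((H.page r).sc (k, l)).g.hom),
        y.1 = cls (K.ssZ c r k (k + l)) (K.ssB c r k (k + l)) z h →
          e (Submodule.Quotient.mk y) = cls _ _ z h' := by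
  -- The homology is defined by the abstract successor and predecessor of `(k, l)`.
  have hnext : (ComplexShape.up' ((r, 1 - r) : ℤ × ℤ)).next (k, l) = (k + r, l + 1 - r) :=
    ComplexShape.next_eq' _ (rel_iff.2 ⟨rfl, rfl⟩)
  have hprev : (ComplexShape.up' ((r, 1 - r) : ℤ × ℤ)).prev (k, l) = (k - r, l - 1 + r) :=
    ComplexShape.prev_eq' _ (rel_iff.2 ⟨by omega, by omega⟩)
  have hker : ∀ ξ : Page K c r k (k + l), ((H.page r).sc (k, l)).g.hom ξ = 0 ↔
      ∃ z, ∃ h : z ∈ K.ssZ c r k (k + l), z ∈ K.ssZ c (r + 1) k (k + l) ∧ cls _ _ z h = ξ := by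
    intro ξ
    refine (sc_g_eq_zero_iff (H.page r) hnext ξ).trans ?_
    rw [H.page_d rfl rfl]
    exact H.pageD_eq_zero_iff rfl (by omega) ξ
  have hle : ∀ z ∈ K.ssZ c (r + 1) k (k + l), z ∈ K.ssZ c r k (k + l) := fun z hz =>
    H.ssZ_mono le_rfl (by omega) hz
  let f₀ : K.ssZ c (r + 1) k (k + l) →ₗ[F2] LinearMap.ker ((H.page r).sc (k, l)).g.hom :=
    ((K.ssB c r k (k + l)).submoduleOf (K.ssZ c r k (k + l))).mkQ.comp
      (Submodule.inclusion hle) |>.codRestrict _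
        fun z => (hker _).2 ⟨z.1, hle _ z.2, z.2, rfl⟩
  obtain ⟨e, he⟩ := exists_equiv_of_ker_eq (f := (Submodule.mkQ (LinearMap.range
      ((H.page r).sc (k, l)).moduleCatToCycles)).comp f₀)
    (g := ((K.ssB c (r + 1) k (k + l)).submoduleOf (K.ssZ c (r + 1) k (k + l))).mkQ)
    ((Submodule.mkQ_surjective _).comp fun y => by
      obtain ⟨z, h, h', hz⟩ := (hker y.1).1 y.2
      exact ⟨⟨z, h'⟩, Subtype.ext hz⟩)
    (Submodule.mkQ_surjective _) (fun z => by
      rw [LinearMap.comp_apply, Submodule.mkQ_apply, Submodule.mkQ_apply,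
        Submodule.Quotient.mk_eq_zero, Submodule.Quotient.mk_eq_zero]
      refine Iff.trans ?_ (H.cls_mem_range_pageD_iff (k' := k - r) (n' := k - r + (l - 1 + r)) rfl
        (by omega) (hle _ z.2) z.2)
      refine Iff.trans ?_ ((mem_range_sc_f_iff (H.page r) hprev
        (cls (K.ssZ c r k (k + l)) (K.ssB c r k (k + l)) z.1 (hle _ z.2))).trans ?_)
      · exact ⟨fun ⟨η, hη⟩ => ⟨η, congrArg Subtype.val hη⟩, fun ⟨η, hη⟩ => ⟨η, Subtype.ext hη⟩⟩
      · refine exists_congr fun η => ?_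
        have h1 := H.page_d (r := r) (k := k - r) (l := l - 1 + r) (k' := k) (l' := l)
          (by omega) (by omega) η
        exact ⟨fun h => h1.symm.trans h, fun h => h1.trans h⟩)
  refine ⟨e, fun z h h' y hy => ?_⟩
  rw [← show e _ = cls _ _ z h' from he ⟨z, h'⟩]
  exact congrArg (fun y => e (Submodule.Quotient.mk y)) (Subtype.ext hy)

/-- The homology of a page, as the explicit quotient of the kernel of the differential by its
image, is the next page. -/
noncomputable def homologyEquiv (r k l : ℤ) :
    (LinearMap.ker ((H.page r).sc (k, l)).g.hom ⧸
      LinearMap.range ((H.page r).sc (k, l)).moduleCatToCycles) ≃ₗ[F2] Page K c (r + 1) k (k + l) :=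
  (H.exists_homology_equiv r k l).choose

theorem homologyEquiv_mk {r k l : ℤ} {z : K.V} (h : z ∈ K.ssZ c r k (k + l))
    (h' : z ∈ K.ssZ c (r + 1) k (k + l)) (y : LinearMap.ker ((H.page r).sc (k, l)).g.hom)
    (hy : y.1 = cls (K.ssZ c r k (k + l)) (K.ssB c r k (k + l)) z h) :
    H.homologyEquiv r k l (Submodule.Quotient.mk y) = cls _ _ z h' :=
  (H.exists_homology_equiv r k l).choose_spec z h h' y hy

/-- The isomorphism from the homology of a page to the next page. -/
noncomputable def pageIso (r k l : ℤ) : (H.page r).homology (k, l) ≅ (H.page (r + 1)).X (k, l) :=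
  ((H.page r).sc (k, l)).moduleCatHomologyIso ≪≫ (H.homologyEquiv r k l).toModuleIso

theorem pageIso_hom_homologyπ {r k l : ℤ} {z : K.V} (h : z ∈ K.ssZ c r k (k + l))
    (h' : z ∈ K.ssZ c (r + 1) k (k + l)) (y : (H.page r).cycles (k, l))
    (hy : (H.page r).iCycles (k, l) y = cls (K.ssZ c r k (k + l)) (K.ssB c r k (k + l)) z h) :
    (H.pageIso r k l).hom ((H.page r).homologyπ (k, l) y) =
      cls (K.ssZ c (r + 1) k (k + l)) (K.ssB c (r + 1) k (k + l)) z h' := by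
  have h1 := ConcreteCategory.congr_hom ((H.page r).sc (k, l)).moduleCatCyclesIso_hom_i y
  have h2 : ((H.page r).sc (k, l)).moduleCatHomologyIso.hom ((H.page r).homologyπ (k, l) y) =
      ((H.page r).sc (k, l)).moduleCatLeftHomologyData.π
        (((H.page r).sc (k, l)).moduleCatCyclesIso.hom y) :=
    ConcreteCategory.congr_hom ((H.page r).sc (k, l)).π_moduleCatCyclesIso_hom y
  change H.homologyEquiv r k l (((H.page r).sc (k, l)).moduleCatHomologyIso.hom
    ((H.page r).homologyπ (k, l) y)) = _
  rw [h2]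
  exact H.homologyEquiv_mk h h' (((H.page r).sc (k, l)).moduleCatCyclesIso.hom y) (h1.trans hy)

/-- The spectral sequence of the filtered complex. -/
noncomputable def spectralSequence : CohomologicalSpectralSequence (ModuleCat.{0} F2) 0 where
  page r _ := H.page r
  iso r _ pq hr _ := hr ▸ H.pageIso r pq.1 pq.2

/-- The spectral sequence with its identification of the pages by representatives. -/
noncomputable def presents : K.Presents c H.spectralSequence where
  π r _ k l := ((K.ssB c r k (k + l)).submoduleOf (K.ssZ c r k (k + l))).mkQ
  surj _ _ _ _ := Submodule.mkQ_surjective _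
  ker _ _ _ _ := Submodule.ker_mkQ _
  diff r hr k l z := ⟨H.d_mem_ssZ rfl (by omega) z.2, H.page_d_cls rfl rfl z.2⟩
  iso r hr k l z h h' y hy := H.pageIso_hom_homologyπ h h' y hy

end IsBigradedComplex

/-! ### Convergence -/

theorem cls_mem_filBN_iff {K : Theory} {c k i : ℤ} {z : K.V} {hz : z ∈ K.bnZ i} :
    cls (K.bnZ i) (K.bnB i) z hz ∈ K.filBN c k i ↔
      ∃ w ∈ K.fil c k, w ∈ K.bnZ i ∧ w - z ∈ K.bnB i := by
  constructor
  · rintro ⟨⟨w, hw⟩, hwk, h⟩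
    exact ⟨w, hwk, hw, cls_eq_cls_iff.1 h⟩
  · rintro ⟨w, hwk, hw, h⟩
    exact ⟨⟨w, hw⟩, hwk, cls_eq_cls_iff.2 h⟩

namespace IsBigradedComplex

variable {K : Theory} {c : ℤ} (H : K.IsBigradedComplex c)

include H in
theorem filBN_anti (i : ℤ) : Antitone fun k => K.filBN c k i := fun _ _ h =>
  Submodule.map_mono fun _ hz => H.fil_anti h hz

theorem filBN_eq_bot {k : ℤ} (h : K.fil c k = ⊥) (i : ℤ) : K.filBN c k i = ⊥ := by
  refine (Submodule.eq_bot_iff _).2 ?_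
  rintro _ ⟨z, hz, rfl⟩
  have hz' : z.1 ∈ K.fil c k := hz
  rw [h, Submodule.mem_bot] at hz'
  rw [show z = 0 from Subtype.ext hz', map_zero]

theorem filBN_eq_top {k : ℤ} (h : K.fil c k = ⊤) (i : ℤ) : K.filBN c k i = ⊤ := by
  refine Submodule.eq_top_iff'.2 fun ξ => ?_
  obtain ⟨z, hz, rfl⟩ := exists_eq_cls ξ
  exact ⟨⟨z, hz⟩, show z ∈ K.fil c k by rw [h]; trivial, rfl⟩

section Stable

variable {k₀ k₁ r k n : ℤ} (h₀ : K.fil c k₀ = ⊤) (h₁ : K.fil c k₁ = ⊥) (hr : k₁ - k₀ + 1 ≤ r)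

include H h₁ in
theorem eq_zero_of_mem_fil (h : k₁ ≤ k) {z : K.V} (hz : z ∈ K.fil c k) : z = 0 := by
  have := H.fil_le h hz
  rwa [h₁, Submodule.mem_bot] at this

include H h₀ in
theorem mem_fil_of_le (h : k ≤ k₀) (z : K.V) : z ∈ K.fil c k :=
  H.fil_le h (by rw [h₀]; trivial)

include H h₀ h₁ hr in
/-- For large `r`, either `F^{k+r} = 0`, or `F^{k+1}` is everything and `E_r^{k,l}` vanishes. -/
theorem d_eq_zero_or {z : K.V} (hz : z ∈ K.ssZ c r k n) :
    K.d z = 0 ∨ z ∈ K.ssZ c (r - 1) (k + 1) n := by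
  by_cases h : k₁ ≤ k + r
  · exact .inl (H.eq_zero_of_mem_fil h₁ h (mem_ssZ.1 hz).2.2)
  · refine .inr (mem_ssZ.2 ⟨H.mem_fil_of_le h₀ (by omega) z, (mem_ssZ.1 hz).2.1, ?_⟩)
    exact H.fil_le (by omega) (mem_ssZ.1 hz).2.2

include H h₀ h₁ hr in
theorem pageD_eq_zero {k' n' : ℤ} (hk : k' = k + r) (hn : n' = n + 1) (ξ : Page K c r k n) :
    pageD K c r k n k' n' ξ = 0 := by
  obtain ⟨z, hz, rfl⟩ := exists_eq_cls ξ
  rcases H.d_eq_zero_or h₀ h₁ hr hz with h | h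
  · rw [H.pageD_cls hk hn, cls_eq_zero_iff, h]
    exact Submodule.zero_mem _
  · have h' : z ∈ K.ssB c r k n := Submodule.mem_sup_left h
    rw [(cls_eq_zero_iff (hz := hz)).2 h', map_zero]

include H h₀ h₁ hr in
/-- From the page `k₁ - k₀ + 1` on, `E_r` is the associated graded of Bar-Natan homology: both are
quotients of the cocycles in `F^k`, by the same subspace. -/
theorem exists_page_equiv_grBN : ∃ e : Page K c r k n ≃ₗ[F2] K.grBN c k n,
    ∀ (z : K.V) (h : z ∈ K.ssZ c r k n) (hz : z ∈ K.bnZ n),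
      ∃ h' : cls (K.bnZ n) (K.bnB n) z hz ∈ K.filBN c k n,
        e (cls _ _ z h) = cls _ _ (cls _ _ z hz) h' := by
  have hf : ∀ z ∈ K.fil c k ⊓ K.bnZ n, z ∈ K.ssZ c r k n := fun z hz =>
    mem_ssZ.2 ⟨hz.1, hz.2.1, by
      rw [LinearMap.mem_ker.1 hz.2.2]
      exact Submodule.zero_mem _⟩
  have hg : ∀ z : (K.fil c k ⊓ K.bnZ n : Submodule F2 K.V),
      ((K.bnB n).submoduleOf (K.bnZ n)).mkQ (Submodule.inclusion inf_le_right z) ∈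
        K.filBN c k n := fun z => ⟨_, z.2.1, rfl⟩
  obtain ⟨e, he⟩ := exists_equiv_of_ker_eq
    (f := ((K.ssB c r k n).submoduleOf (K.ssZ c r k n)).mkQ ∘ₗ Submodule.inclusion hf)
    (g := ((K.filBN c (k + 1) n).submoduleOf (K.filBN c k n)).mkQ ∘ₗ
      (((K.bnB n).submoduleOf (K.bnZ n)).mkQ ∘ₗ Submodule.inclusion inf_le_right).codRestrict _ hg)
    (by
      intro ξ
      obtain ⟨z, hz, rfl⟩ := exists_eq_cls ξ
      rcases H.d_eq_zero_or h₀ h₁ hr hz with h | h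
      · exact ⟨⟨z, (mem_ssZ.1 hz).1, (mem_ssZ.1 hz).2.1, h⟩, rfl⟩
      · exact ⟨0, (map_zero _).trans (cls_eq_zero_iff.2 (Submodule.mem_sup_left h)).symm⟩)
    (by
      intro ξ
      obtain ⟨η, hη, rfl⟩ := exists_eq_cls (V := K.BN n) ξ
      obtain ⟨w, hw, rfl⟩ := hη
      exact ⟨⟨w.1, hw, w.2⟩, rfl⟩)
    (by
      rintro ⟨z, hz⟩
      refine Iff.trans (b := z ∈ K.ssB c r k n) cls_eq_zero_iff (Iff.trans ?_
        (cls_eq_zero_iff (hz := hg ⟨z, hz⟩)).symm)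
      refine Iff.trans ?_ (cls_mem_filBN_iff (hz := hz.2)).symm
      constructor
      · intro h
        obtain ⟨w, hw, v, hv, rfl⟩ := mem_ssB.1 h
        refine ⟨w, (mem_ssZ.1 hw).1, ⟨(mem_ssZ.1 hw).2.1, ?_⟩, - v,
          Submodule.neg_mem _ (mem_ssZ.1 hv).2.1, by rw [map_neg]; abel⟩
        have h2 : K.d (w + K.d v) = 0 := hz.2.2
        rwa [map_add, H.d_d_apply, add_zero] at h2
      · rintro ⟨w, hw, hwZ, v, hv, hvw⟩
        -- If `F^k ≠ 0`, then `r` is so large that `F^{k-r+1}` contains every cochain `v`.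
        by_cases hk : k₁ ≤ k
        · rw [H.eq_zero_of_mem_fil h₁ hk hz.1]
          exact Submodule.zero_mem _
        refine mem_ssB.2 ⟨w, mem_ssZ.2 ⟨hw, hwZ.1, ?_⟩, - v, ?_, by rw [map_neg, hvw]; abel⟩
        · rw [LinearMap.mem_ker.1 hwZ.2]
          exact Submodule.zero_mem _
        · refine Submodule.neg_mem _ (mem_ssZ.2 ⟨H.mem_fil_of_le h₀ (by omega) v, hv, ?_⟩)
          rw [hvw]
          exact Submodule.sub_mem _ (H.fil_le (by omega) hw) (H.fil_le (by omega) hz.1))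
  refine ⟨e, fun z h hz => ⟨hg ⟨z, (mem_ssZ.1 h).1, hz⟩, ?_⟩⟩
  exact he ⟨z, (mem_ssZ.1 h).1, hz⟩

end Stable

theorem converges : H.presents.Converges := by
  obtain ⟨k₀, h₀⟩ := H.fil_top
  obtain ⟨k₁, h₁⟩ := H.fil_bot
  refine ⟨H.filBN_anti, ⟨k₁, filBN_eq_bot h₁⟩, ⟨k₀, filBN_eq_top h₀⟩, max 0 (k₁ - k₀ + 1),
    le_max_left _ _, fun r hr hR => ⟨?_, fun k l => ?_⟩⟩
  · rintro ⟨k, l⟩ ⟨k', l'⟩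
    by_cases h : (ComplexShape.up' ((r, 1 - r) : ℤ × ℤ)).Rel (k, l) (k', l')
    · obtain ⟨hk, hl⟩ := rel_iff.1 h
      refine ModuleCat.hom_ext (LinearMap.ext fun ξ => ?_)
      exact (H.page_d hk hl ξ).trans (H.pageD_eq_zero h₀ h₁ ((le_max_right _ _).trans hR) hk
        (by omega) ξ)
    · exact (H.page r).shape _ _ h
  · exact H.exists_page_equiv_grBN h₀ h₁ ((le_max_right _ _).trans hR)

/-! ### The first pages -/

include H in
theorem mem_ssB_of_mem_fil {r k n : ℤ} (hr : r ≤ 1) {z : K.V} (hz : z ∈ K.fil c (k + 1))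
    (hn : z ∈ K.cochains n) : z ∈ K.ssB c r k n :=
  Submodule.mem_sup_left (mem_ssZ.2 ⟨hz, hn, H.fil_le (by omega) (H.d_mem_fil hz)⟩)

include H in
theorem bideg_le_ssZ_zero {k n : ℤ} {z : K.V} (hz : z ∈ K.bideg n (2 * k + c)) :
    z ∈ K.ssZ c 0 k n :=
  mem_ssZ.2 ⟨H.bideg_le_fil le_rfl hz, bideg_le_cochains K _ _ hz,
    H.fil_le (by omega) (H.d_mem_fil (H.bideg_le_fil le_rfl hz))⟩

include H in
theorem beta_mem_ssB {r k n n' : ℤ} (hr : r ≤ 1) (hn : n' = n + 1) {z : K.V}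
    (hz : z ∈ K.bideg n (2 * k + c)) : K.beta z ∈ K.ssB c r k n' :=
  H.mem_ssB_of_mem_fil hr (H.beta_mem_fil (H.bideg_le_fil le_rfl hz))
    (bideg_le_cochains K _ _ (H.beta_mem_bideg hn rfl hz))

include H in
theorem exists_pageZero_equiv (k n : ℤ) : ∃ e : Page K c 0 k n ≃ₗ[F2] K.bideg n (2 * k + c),
    ∀ (z : K.V) (hz : z ∈ K.bideg n (2 * k + c)),
      e (cls _ _ z (H.bideg_le_ssZ_zero hz)) = ⟨z, hz⟩ := by
  obtain ⟨e, he⟩ := exists_equiv_of_ker_eq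
    (f := ((K.ssB c 0 k n).submoduleOf (K.ssZ c 0 k n)).mkQ ∘ₗ
      Submodule.inclusion fun z hz => H.bideg_le_ssZ_zero hz)
    (g := (LinearMap.id : K.bideg n (2 * k + c) →ₗ[F2] K.bideg n (2 * k + c)))
    (by
      intro ξ
      obtain ⟨z, hz, rfl⟩ := exists_eq_cls ξ
      refine ⟨⟨_, H.proj_mem n (2 * k + c) z⟩, (cls_eq_cls_iff (hz := hz)
        (hw := H.bideg_le_ssZ_zero (H.proj_mem n (2 * k + c) z))).2 ?_ |>.symm⟩
      exact H.mem_ssB_of_mem_fil zero_le_one (H.sub_proj_mem (mem_ssZ.1 hz).1 (mem_ssZ.1 hz).2.1)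
        (Submodule.sub_mem _ (mem_ssZ.1 hz).2.1
          (bideg_le_cochains K _ _ (H.proj_mem n (2 * k + c) z))))
    Function.surjective_id
    (by
      rintro ⟨z, hz⟩
      refine Iff.trans (b := z ∈ K.ssB c 0 k n) cls_eq_zero_iff ⟨fun h => ?_, fun h => ?_⟩
      · obtain ⟨w, hw, v, hv, hwv⟩ := mem_ssB.1 h
        have h1 : z ∈ K.fil c (k + 1) := by
          rw [← hwv]
          exact Submodule.add_mem _ (mem_ssZ.1 hw).1
            (H.d_mem_fil (H.fil_le (by omega) (mem_ssZ.1 hv).1))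
        refine Subtype.ext ?_
        change z = 0
        rw [← H.proj_of_mem hz, H.proj_eq_zero_of_mem_fil h1]
      · have : z = 0 := congrArg Subtype.val h
        rw [this]
        exact Submodule.zero_mem _)
  exact ⟨e, fun z hz => he ⟨z, hz⟩⟩

include H in
theorem khZ_le_ssZ_one {k n : ℤ} {z : K.V} (hz : z ∈ K.khZ n (2 * k + c)) :
    z ∈ K.ssZ c 1 k n :=
  mem_ssZ.2 ⟨H.bideg_le_fil le_rfl hz.1, bideg_le_cochains K _ _ hz.1, by
    rw [H.d_apply, LinearMap.mem_ker.1 hz.2, zero_add]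
    exact H.beta_mem_fil (H.bideg_le_fil le_rfl hz.1)⟩

theorem proj_mem_khZ {k n : ℤ} {z : K.V} (hz : z ∈ K.ssZ c 1 k n) :
    H.proj n (2 * k + c) z ∈ K.khZ n (2 * k + c) := by
  refine ⟨H.proj_mem _ _ _, ?_⟩
  change K.del _ = 0
  rw [← H.proj_d rfl (mem_ssZ.1 hz).1, H.proj_eq_zero_of_mem_fil (mem_ssZ.1 hz).2.2]

theorem exists_pageOne_equiv (k n : ℤ) : ∃ e : Page K c 1 k n ≃ₗ[F2] K.Kh n (2 * k + c),
    ∀ (z : K.V) (hz : z ∈ K.khZ n (2 * k + c)),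
      e (cls _ _ z (H.khZ_le_ssZ_one hz)) = cls _ _ z hz := by
  obtain ⟨e, he⟩ := exists_equiv_of_ker_eq
    (f := ((K.ssB c 1 k n).submoduleOf (K.ssZ c 1 k n)).mkQ ∘ₗ
      Submodule.inclusion fun z hz => H.khZ_le_ssZ_one hz)
    (g := ((K.khB n (2 * k + c)).submoduleOf (K.khZ n (2 * k + c))).mkQ)
    (by
      intro ξ
      obtain ⟨z, hz, rfl⟩ := exists_eq_cls ξ
      refine ⟨⟨_, H.proj_mem_khZ hz⟩, (cls_eq_cls_iff (hz := hz)
        (hw := H.khZ_le_ssZ_one (H.proj_mem_khZ hz))).2 ?_ |>.symm⟩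
      exact H.mem_ssB_of_mem_fil le_rfl (H.sub_proj_mem (mem_ssZ.1 hz).1 (mem_ssZ.1 hz).2.1)
        (Submodule.sub_mem _ (mem_ssZ.1 hz).2.1
          (bideg_le_cochains K _ _ (H.proj_mem n (2 * k + c) z))))
    (Submodule.mkQ_surjective _)
    (by
      rintro ⟨z, hz⟩
      refine Iff.trans (b := z ∈ K.ssB c 1 k n) cls_eq_zero_iff
        (Iff.trans ?_ (cls_eq_zero_iff (hz := hz)).symm)
      constructor
      · intro h
        obtain ⟨w, hw, v, hv, hwv⟩ := mem_ssB.1 h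
        rw [show k - 1 + 1 = k by omega] at hv
        refine ⟨H.proj (n - 1) (2 * k + c) v, H.proj_mem _ _ _, ?_⟩
        rw [← H.proj_d (n' := n) (by omega) (mem_ssZ.1 hv).1]
        have h1 := congrArg (H.proj n (2 * k + c)) hwv
        rwa [map_add, H.proj_eq_zero_of_mem_fil (mem_ssZ.1 hw).1, zero_add,
          H.proj_of_mem hz.1] at h1
      · rintro ⟨v, hv, hvz⟩
        have h1 : z = - K.beta v + K.d v := by rw [H.d_apply, hvz]; abel
        rw [h1]
        refine Submodule.add_mem _
          (Submodule.neg_mem _ (H.beta_mem_ssB le_rfl (by omega) hv)) ?_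
        refine Submodule.mem_sup_right ⟨v, ?_, rfl⟩
        rw [show k - 1 + 1 = k by omega]
        exact H.bideg_le_ssZ_zero hv)
  exact ⟨e, fun z hz => he ⟨z, hz⟩⟩

/-- The page `E_1` is Khovanov homology, by the identity on representatives in `khZ`. -/
noncomputable def pageOneEquiv (k n : ℤ) : Page K c 1 k n ≃ₗ[F2] K.Kh n (2 * k + c) :=
  (H.exists_pageOne_equiv k n).choose

theorem pageOneEquiv_cls {k n : ℤ} {z : K.V} (hz : z ∈ K.khZ n (2 * k + c)) :
    H.pageOneEquiv k n (cls _ _ z (H.khZ_le_ssZ_one hz)) = cls _ _ z hz :=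
  (H.exists_pageOne_equiv k n).choose_spec z hz

theorem exists_eq_cls_khZ {k n : ℤ} (ξ : Page K c 1 k n) :
    ∃ z, ∃ hz : z ∈ K.khZ n (2 * k + c), cls _ _ z (H.khZ_le_ssZ_one hz) = ξ := by
  obtain ⟨z, hz, h⟩ := exists_eq_cls (H.pageOneEquiv k n ξ)
  refine ⟨z, hz, (H.pageOneEquiv k n).injective ?_⟩
  rw [H.pageOneEquiv_cls hz, h]

/-- The differential `d_1` is `β_*`: on a cocycle of `∂`, `d` is `β`. -/
theorem pageOneEquiv_pageD {k n k' n' : ℤ} (hk : k' = k + 1) (hn : n' = n + 1)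
    (ξ : Page K c 1 k n) : H.pageOneEquiv k' n' (pageD K c 1 k n k' n' ξ) =
      K.betaStar n (2 * k + c) n' (2 * k' + c) (H.pageOneEquiv k n ξ) := by
  obtain ⟨z, hz, rfl⟩ := H.exists_eq_cls_khZ ξ
  rw [H.pageOneEquiv_cls hz, H.betaStar_cls hn (by omega), H.pageD_cls hk hn,
    ← H.pageOneEquiv_cls (H.beta_mem_khZ hn (by omega) hz)]
  congr 1
  rw [cls_eq_cls_iff, H.d_apply, LinearMap.mem_ker.1 hz.2, zero_add, sub_self]
  exact Submodule.zero_mem _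

theorem pageOneEquiv_mem_secZ_iff {k n : ℤ} (ξ : Page K c 1 k n) :
    H.pageOneEquiv k n ξ ∈ K.secZ n (2 * k + c) ↔ pageD K c 1 k n (k + 1) (n + 1) ξ = 0 := by
  -- The degrees `2 * (k + 1) + c` and `2 * k + c + 2` are only propositionally equal.
  have h : ∀ j', j' = 2 * k + c + 2 → (K.betaStar n (2 * k + c) (n + 1) j'
      (H.pageOneEquiv k n ξ) = 0 ↔ H.pageOneEquiv k n ξ ∈ K.secZ n (2 * k + c)) := by
    rintro _ rfl; rfl
  rw [← h (2 * (k + 1) + c) (by omega), ← H.pageOneEquiv_pageD rfl rfl]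
  exact LinearEquiv.map_eq_zero_iff _

theorem pageOneEquiv_mem_secB_iff {k n : ℤ} (ξ : Page K c 1 k n) :
    H.pageOneEquiv k n ξ ∈ K.secB n (2 * k + c) ↔
      ∃ η, pageD K c 1 (k - 1) (n - 1) k n η = ξ := by
  have h : ∀ j', j' = 2 * k + c - 2 → ((∃ η, K.betaStar (n - 1) j' n (2 * k + c) η =
      H.pageOneEquiv k n ξ) ↔ H.pageOneEquiv k n ξ ∈ K.secB n (2 * k + c)) := by
    rintro _ rfl; rfl
  rw [← h (2 * (k - 1) + c) (by omega),
    ← (H.pageOneEquiv (k - 1) (n - 1)).toEquiv.exists_congr_right]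
  refine exists_congr fun η => ?_
  rw [← (H.pageOneEquiv k n).injective.eq_iff, H.pageOneEquiv_pageD (by omega) (by omega)]
  rfl

theorem exists_pageTwo_equiv (k n : ℤ) : ∃ e : Page K c 2 k n ≃ₗ[F2] K.Sec n (2 * k + c),
    ∀ (z : K.V) (h₁ : z ∈ K.ssZ c 1 k n) (h₂ : z ∈ K.ssZ c 2 k n),
      ∃ h : H.pageOneEquiv k n (cls _ _ z h₁) ∈ K.secZ n (2 * k + c),
        e (cls _ _ z h₂) = cls _ _ _ h := by
  have hle : ∀ z ∈ K.ssZ c 2 k n, z ∈ K.ssZ c 1 k n := fun z hz =>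
    H.ssZ_mono le_rfl (by omega) hz
  have hg : ∀ z : K.ssZ c 2 k n, H.pageOneEquiv k n
      (((K.ssB c 1 k n).submoduleOf (K.ssZ c 1 k n)).mkQ (Submodule.inclusion hle z)) ∈
        K.secZ n (2 * k + c) := fun z =>
    (H.pageOneEquiv_mem_secZ_iff _).2 ((H.pageD_eq_zero_iff rfl rfl _).2
      ⟨z.1, hle _ z.2, z.2, rfl⟩)
  obtain ⟨e, he⟩ := exists_equiv_of_ker_eq
    (f := ((K.ssB c 2 k n).submoduleOf (K.ssZ c 2 k n)).mkQ)
    (g := ((K.secB n (2 * k + c)).submoduleOf (K.secZ n (2 * k + c))).mkQ ∘ₗ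
      ((H.pageOneEquiv k n).toLinearMap ∘ₗ ((K.ssB c 1 k n).submoduleOf (K.ssZ c 1 k n)).mkQ ∘ₗ
        Submodule.inclusion hle).codRestrict _ hg)
    (Submodule.mkQ_surjective _)
    (by
      intro ξ
      obtain ⟨η, hη, rfl⟩ := exists_eq_cls (V := K.Kh n (2 * k + c)) ξ
      obtain ⟨ζ, rfl⟩ := (H.pageOneEquiv k n).surjective η
      obtain ⟨z, hz, hz', rfl⟩ := (H.pageD_eq_zero_iff rfl rfl _).1
        ((H.pageOneEquiv_mem_secZ_iff _).1 hη)
      exact ⟨⟨z, hz'⟩, rfl⟩)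
    (by
      intro z
      refine Iff.trans (b := z.1 ∈ K.ssB c 2 k n) cls_eq_zero_iff
        (Iff.trans ?_ (cls_eq_zero_iff (hz := hg z)).symm)
      refine Iff.trans ?_ (H.pageOneEquiv_mem_secB_iff (cls _ _ z.1 (hle _ z.2))).symm
      exact (H.cls_mem_range_pageD_iff rfl rfl (hle _ z.2) z.2).symm)
  exact ⟨e, fun z h₁ h₂ => ⟨hg ⟨z, h₂⟩, he ⟨z, h₂⟩⟩⟩

theorem nonempty_firstPages : Nonempty H.presents.FirstPages := by
  choose e₀ he₀ using H.exists_pageZero_equiv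
  choose e₂ he₂ using H.exists_pageTwo_equiv
  refine ⟨{
    e₀ := fun k l => e₀ k (k + l)
    e₀_cls := fun k l z hz => ⟨H.bideg_le_ssZ_zero hz, he₀ k (k + l) z hz⟩
    e₀_diff := fun k l ξ => ?_
    e₁ := fun k l => H.pageOneEquiv k (k + l)
    e₁_cls := fun k l z hz => ⟨H.khZ_le_ssZ_one hz, H.pageOneEquiv_cls hz⟩
    e₁_diff := fun k l ξ => ?_
    e₂ := fun k l => e₂ k (k + l)
    e₂_cls := fun k l z h₁ h₂ => he₂ k (k + l) z h₁ h₂ }⟩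
  · obtain ⟨⟨z, hz⟩, rfl⟩ := (e₀ k (k + l)).symm.surjective ξ
    have h1 : (e₀ k (k + l)).symm ⟨z, hz⟩ = cls _ _ z (H.bideg_le_ssZ_zero hz) := by
      rw [LinearEquiv.symm_apply_eq, he₀]
    have h2 : K.del z ∈ K.bideg (k + (l + 1)) (2 * k + c) := H.del_mem_bideg (by omega) hz
    have h3 : ((H.page 0).d (k, l) (k, l + 1)).hom ((e₀ k (k + l)).symm ⟨z, hz⟩) =
        cls _ _ (K.del z) (H.bideg_le_ssZ_zero h2) := by
      rw [h1]
      refine (H.page_d_cls (by omega) (by omega) _).trans (cls_eq_cls_iff.2 ?_)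
      rw [H.d_apply, add_sub_cancel_left]
      exact H.beta_mem_ssB zero_le_one (by omega) hz
    exact (congrArg Subtype.val ((congrArg (e₀ k (k + (l + 1))) h3).trans (he₀ _ _ _ h2))).trans
      (congrArg (fun w : K.bideg (k + l) (2 * k + c) => K.del w.1)
        ((e₀ k (k + l)).apply_symm_apply ⟨z, hz⟩)).symm
  · have h1 : ((H.page 1).d (k, l) (k + 1, l)).hom ξ = _ := H.page_d rfl (by omega) ξ
    exact (congrArg (H.pageOneEquiv (k + 1) (k + 1 + l)) h1).trans
      (H.pageOneEquiv_pageD rfl (by omega) ξ)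

end IsBigradedComplex
end Theory

/-! ### The theories of a link diagram -/

/-- Subspaces that span and are cut out by conditions on the support of coordinate vectors form a
grading. -/
theorem isInternal_of_coordinates {V X ι : Type*} [DecidableEq ι] [AddCommGroup V] [Module F2 V]
    {ρ : V →ₗ[F2] (X → F2)} (hρ : Function.Injective ρ) (deg : X → ι) {A : ι → Submodule F2 V}
    (hA : ∀ i, ∀ v ∈ A i, ∀ x, deg x ≠ i → ρ v x = 0) (hsup : iSup A = ⊤) :
    DirectSum.IsInternal A := by
  refine DirectSum.isInternal_submodule_of_iSupIndep_of_iSup_eq_top (fun i => ?_) hsup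
  rw [Submodule.disjoint_def]
  intro v hv hv'
  refine hρ ?_
  rw [map_zero]
  ext x
  by_cases hx : deg x = i
  · have hle : ⨆ (j) (_ : j ≠ i), A j ≤ LinearMap.ker (LinearMap.proj x ∘ₗ ρ) :=
      iSup₂_le fun j hj w hw => hA j w hw x (by rw [hx]; exact hj.symm)
    exact hle hv'
  · exact hA i v hv x hx

theorem quotMap_mkQ {V : Type} [AddCommGroup V] [Module F2 V] {N : Submodule F2 V}
    {f : V →ₗ[F2] V} (h : ∀ z ∈ N, f z ∈ N) (z : V) :
    quotMap N f (N.mkQ z) = N.mkQ (f z) := by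
  have h' : N ≤ N.comap f := h
  unfold quotMap
  rw [dif_pos h']
  rfl

namespace LinkDiagram

theorem iSup_chainDeg (D : LinkDiagram) : ⨆ ij : ℤ × ℤ, D.chainDeg ij.1 ij.2 = ⊤ := by
  classical
  refine Submodule.eq_top_iff'.2 fun v => ?_
  rw [pi_eq_sum_univ' v]
  refine Submodule.sum_mem _ fun S _ => Submodule.smul_mem _ _ ?_
  refine Submodule.mem_iSup_of_mem (S.hdeg, S.qdeg) fun T hT => ?_
  by_cases hTS : T = S
  · rw [hTS]; exact ⟨rfl, rfl⟩
  · exact absurd (Pi.single_eq_of_ne hTS 1) hT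

theorem chainDeg_eq_bot (D : LinkDiagram) {i j : ℤ} (h : ¬ ∃ k, j = 2 * k + D.gamma) :
    D.chainDeg i j = ⊥ := by
  refine (Submodule.eq_bot_iff _).2 fun v hv => ?_
  ext S
  by_contra hS
  obtain ⟨k, hk⟩ := exists_qdeg_eq S
  exact h ⟨k, by rw [← (hv S hS).2, hk]⟩

theorem apply_eq_zero_of_mem_chainDeg {D : LinkDiagram} {i j : ℤ} {v : D.Chain}
    (hv : v ∈ D.chainDeg i j) {S : D.State} (h : (S.hdeg, S.qdeg) ≠ (i, j)) : v S = 0 := by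
  by_contra hS
  exact h (Prod.ext (hv S hS).1 (hv S hS).2)

theorem isBigradedComplex_theory (D : LinkDiagram) : D.theory.IsBigradedComplex D.gamma where
  finite := inferInstanceAs (Module.Finite F2 (D.State → F2))
  bigraded := isInternal_of_coordinates (V := D.Chain) (ρ := LinearMap.id) Function.injective_id
    (fun S : D.State => (S.hdeg, S.qdeg))
    (fun _ _ hv _ h => apply_eq_zero_of_mem_chainDeg hv h) D.iSup_chainDeg
  parity _ _ h := D.chainDeg_eq_bot h
  d_eq := D.cubeMap_bnOps_one
  del_mem i j z hz := by
    have := D.cubeMap_mem_chainDeg hasDegree_khOps hz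
    rwa [add_zero] at this
  beta_mem i j z hz := D.cubeMap_mem_chainDeg hasDegree_betaOps hz
  d_d := D.cubeMap_comp_cubeMap

/-- The coordinates of a reduced chain: the states with the label `1` at the base point. -/
noncomputable def reducedCoord (D : LinkDiagram) (p : D.Point) :
    (D.Chain ⧸ D.xChain p) →ₗ[F2] ({S : D.State // S.lab p = .one} → F2) :=
  (D.xChain p).liftQ (LinearMap.funLeft F2 F2 Subtype.val) fun v hv => by
    ext S
    by_contra h
    have := mem_xChain.1 hv S.1 h
    rw [S.2] at this
    cases this

theorem reducedCoord_injective (D : LinkDiagram) (p : D.Point) :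
    Function.Injective (D.reducedCoord p) := by
  rw [← LinearMap.ker_eq_bot, LinearMap.ker_eq_bot']
  intro ξ hξ
  obtain ⟨v, rfl⟩ := Submodule.mkQ_surjective _ ξ
  refine (Submodule.Quotient.mk_eq_zero _).2 (mem_xChain.2 fun S hS => ?_)
  cases h : S.lab p with
  | x => rfl
  | one => exact absurd (congrFun hξ ⟨S, h⟩) hS

theorem isBigradedComplex_reducedTheory (D : LinkDiagram) (p : D.Point) :
    (D.reducedTheory p).IsBigradedComplex (D.gamma + 1) := by
  have hk : ∀ O ∈ [khOps, betaOps, bnOps 1], ∀ z ∈ D.xChain p, D.cubeMap O z ∈ D.xChain p :=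
    fun O hO z hz => cubeMap_mem_xChain (preservesX_of_mem hO) hz
  have hdel := quotMap_mkQ (hk khOps (by simp))
  have hbeta := quotMap_mkQ (hk betaOps (by simp))
  have hd := quotMap_mkQ (hk (bnOps 1) (by simp))
  refine
    { finite := inferInstanceAs (Module.Finite F2 (D.Chain ⧸ D.xChain p))
      bigraded := ?_
      parity := fun i j h => ?_
      d_eq := ?_
      del_mem := ?_
      beta_mem := ?_
      d_d := ?_ }
  · refine isInternal_of_coordinates (V := D.Chain ⧸ D.xChain p) (D.reducedCoord_injective p)
      (fun S => (S.1.hdeg, S.1.qdeg - 1)) ?_ ?_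
    · rintro ⟨i, j⟩ _ ⟨v, hv, rfl⟩ S hS
      refine apply_eq_zero_of_mem_chainDeg (v := v) hv fun h => hS ?_
      rw [Prod.mk.injEq] at h ⊢
      exact ⟨h.1, by omega⟩
    · refine top_le_iff.1 ?_
      rw [← Submodule.range_mkQ (D.xChain p), LinearMap.range_eq_map, ← D.iSup_chainDeg,
        Submodule.map_iSup]
      refine iSup_le fun ij => le_iSup_of_le (ij.1, ij.2 - 1) ?_
      refine Submodule.map_mono (le_of_eq ?_)
      rw [sub_add_cancel]
  · refine (congrArg (Submodule.map (D.xChain p).mkQ)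
      (D.chainDeg_eq_bot (i := i) (j := j + 1) ?_)).trans (Submodule.map_bot _)
    rintro ⟨k, hk⟩
    exact h ⟨k - 1, by omega⟩
  · refine LinearMap.ext fun ξ => ?_
    obtain ⟨z, rfl⟩ := Submodule.mkQ_surjective (D.xChain p) ξ
    refine (hd z).trans ?_
    rw [cubeMap_bnOps_one, LinearMap.add_apply, map_add, ← hdel, ← hbeta]
    rfl
  · rintro i j _ ⟨z, hz, rfl⟩
    have := D.cubeMap_mem_chainDeg hasDegree_khOps hz
    rw [add_zero] at this
    exact ⟨_, this, (hdel z).symm⟩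
  · rintro i j _ ⟨z, hz, rfl⟩
    have := D.cubeMap_mem_chainDeg hasDegree_betaOps hz
    rw [add_right_comm] at this
    exact ⟨_, this, (hbeta z).symm⟩
  · refine LinearMap.ext fun ξ => ?_
    obtain ⟨z, rfl⟩ := Submodule.mkQ_surjective (D.xChain p) ξ
    refine (congrArg _ (hd z)).trans ((hd _).trans ?_)
    rw [← LinearMap.comp_apply (D.cubeMap (bnOps 1)), cubeMap_comp_cubeMap]
    exact map_zero _

end LinkDiagram
end BarNatan

theorem theorem3p2 (D : BarNatan.LinkDiagram) :
    (D.theory.IsFilteredComplex D.gamma ∧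
      ∃ (E : CategoryTheory.CohomologicalSpectralSequence (ModuleCat.{0} BarNatan.F2) 0)
        (P : D.theory.Presents D.gamma E), P.Converges ∧ Nonempty P.FirstPages) ∧
    ∀ p : D.Point,
      (∀ O ∈ [BarNatan.khOps, BarNatan.betaOps, BarNatan.bnOps 1],
        ∀ z ∈ D.xChain p, D.cubeMap O z ∈ D.xChain p) ∧
      (D.reducedTheory p).IsFilteredComplex (D.gamma + 1) ∧
      ∃ (E : CategoryTheory.CohomologicalSpectralSequence (ModuleCat.{0} BarNatan.F2) 0)
        (P : (D.reducedTheory p).Presents (D.gamma + 1) E),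
        P.Converges ∧ Nonempty P.FirstPages := by
  have H := D.isBigradedComplex_theory
  refine ⟨⟨H.isFilteredComplex, H.spectralSequence, H.presents, H.converges,
    H.nonempty_firstPages⟩, fun p => ?_⟩
  have H' := D.isBigradedComplex_reducedTheory p
  exact ⟨fun O hO z hz =>
      BarNatan.LinkDiagram.cubeMap_mem_xChain (BarNatan.preservesX_of_mem hO) hz,
    H'.isFilteredComplex, H'.spectralSequence, H'.presents, H'.converges, H'.nonempty_firstPages⟩
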